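/- Let $J$ be a finite-dimensional simple unital real Jordan algebra with product $xy$, unit $e$, dimension $n$, rank $r$ (the maximal degree of the minimal polynomial of an element), Jordan trace $\mathrm{tr}$ (the linear form such that $-\mathrm{tr}(x)$ is the coefficient of $X^{r-1}$ in the minimal polynomial of each element $x$ whose minimal polynomial has degree $r$) and trace form $\tau(x,y)=\mathrm{tr}(xy)$. Let $\alpha$ be a Cartan involution of $J$, i.e. an involutive automorphism such that $(x|y)=\tau(x,\alpha y)$ is positive definite, and assume that the fixed point algebra of $\alpha$ is simple. Put $L_xy=xy$, $D_{x,y}=2L_{xy}+2[L_x,L_y]$ and $P_{x,y}=L_xL_y+L_yL_x-L_{xy}$, let $\mathfrak{str}(J)$ be the span of all $D_{x,y}$, and let $\mathfrak{co}(J)=V_+\oplus\mathfrak{str}(J)\oplus V_-$ with $V_\pm=J$ be the Tits-Kantor-Koecher Lie algebra, with elements $(u,T,v)$: for $x,y\in V_+$ and $u\in V_-$ one has $[x,u]=D_{x,u}$, $[T,x]=Tx$, $[D_{x,y},u]=-D_{y,x}u$, $[V_\pm,V_\pm]=0$, and the bracket on $\mathfrak{str}(J)$ is the commutator. It is graded by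 $\mathfrak g_{1}=V_+$, $\mathfrak g_0=\mathfrak{str}(J)$, $\mathfrak g_{-1}=V_-$. For a $3$-graded Lie algebra $\mathfrak g=\mathfrak g_1\oplus\mathfrak g_0\oplus\mathfrak g_{-1}$ with a character $\lambda$ of $\mathfrak g_0$, and a basis $(X_i)$ of $\mathfrak g_{-1}$ with partial derivatives $\partial^i$ on $S(\mathfrak g_{-1})$ ($\partial^iX_j=\delta_{ij}$), the $3$-graded realisation $\pi_\lambda$ on $S(\mathfrak g_{-1})$ is $\pi_\lambda(X)=X$ for $X\in\mathfrak g_{-1}$, $\pi_\lambda(X)=\lambda(X)+\sum_i[X,X_i]\partial^i$ for $X\in\mathfrak g_0$, and $\pi_\lambda(X)=\sum_i\lambda([X,X_i])\partial^i+\frac12\sum_{i,j}[[X,X_i],X_j]\partial^j\partial^i$ for $X\in\mathfrak g_1$. Let $\lambda_0\in\mathbb R$ and $\lambda=-\frac{r}{2n}\lambda_0\mathrm{Tr}$ on $\mathfrak{str}(J)$. For a basis $(b_i)$ of $J$ with $\tau$-dual basis $(\bar b_i)$ and $x=\sum_i x_ib_i$, let $$B_{\lambda_0}f(x)=\sum_{i,j}\frac{\partial^2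 f}{\partial x_i\partial x_j}(x)\,P_{\bar b_i,\bar b_j}x+\lambda_0\sum_i\frac{\partial f}{\partial x_i}(x)\,\bar b_i$$ be the classical Bessel operator; it extends complex-linearly to complex-valued functions. Then the following hold, for all bases. 1. $\pi_\lambda$ is a representation of $\mathfrak{co}(J)$ on $S(V_-)=S(J)$. The algebra homomorphism $D:S(J)\to C^\infty(J)$ with $D(v)=\tau(v,\cdot)$ is an isomorphism onto the algebra of polynomial functions on $J$, and there is a representation $\sigma$ of $\mathfrak{co}(J)$ on $C^\infty(J)$ with $\sigma(X)\circ D=D\circ\pi_\lambda(X)$ for all $X$. In it $V_+$ acts by minus the Bessel operator: $\sigma(v,0,0)f=-\tau(v,B_{\lambda_0}f)$. 2. There is an involutive automorphism $\theta$ of $\mathfrak{co}(J)$ with $\theta(u,D_{x,y},v)=(-\alpha v,-D_{\alpha y,\alpha x},-\alpha u)$. The twisted representation $\pi'=\sigma\circ\theta$ on $C^\infty(J)$ is given, for $u,x,y,v\in J$, by $$\pi'(u,0,0)=-(u|\cdot),$$ $$\pi'(0,D_{x,y},0)=\frac{r\lambda_0}{2n}\mathrm{Tr}(D_{\alpha y,\alpha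 x})+\sum_i\tau(e_i,D_{\alpha y,\alpha x}\,\cdot)\,\partial^i,$$ $$\pi'(0,0,v)=\lambda_0\sum_i(v|e_i)\,\partial^i+\sum_{i,j}(v|P_{e_i,e_j}\,\cdot)\,\partial^j\partial^i,$$ where $(e_i)$ is a basis of $J$ and $\partial^i$ is the partial derivative with respect to the coordinates $\tau(e_i,\cdot)$. Thus in $\pi'$ the space $V_-$ acts by the Bessel operator: $\pi'(0,0,v)f=(v|B_{\lambda_0}f)$. 3. There is a representation $\rho$ of $\mathfrak{co}(J)$ on $C^\infty(J,\mathbb C)$ (the one of Hilgert, Kobayashi and Möllers) with $\rho(u,0,0)f(x)=i(u|x)f(x)$, with $\rho(0,T,0)f(x)=df_x(T^*x)+\frac{r\lambda_0}{2n}\mathrm{Tr}(T^*)f(x)$ where $T^*$ is the adjoint of $T$ with respect to $(\cdot|\cdot)$, and with $\rho(0,0,v)f=i(v|B_{\lambda_0}f)$. It arises from $\pi'$ by multiplying the action of $V_\pm$ by $\mp i$: for real-valued $f$, $\rho(u,T,v)f=-i\,\pi'(u,0,0)f+\pi'(0,T,0)f+i\,\pi'(0,0,v)f$. -/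

import Mathlib

open scoped ContDiff

set_option linter.unusedSectionVars false

attribute [local instance] LieRing.ofAssociativeRing

namespace JordanBessel

section Algebra

variable (J : Type*) [NonAssocCommRing J] [Module ℝ J] [IsScalarTower ℝ J J]
  [SMulCommClass ℝ J J]

variable {J} in
/-- The multiplication operator `L_x`. -/
abbrev mulOp (x : J) : Module.End ℝ J := LinearMap.mulLeft ℝ x

variable {J} in
/-- `D_{x,y} z = {x,y,z} = 2 (x (y z) + (x y) z - y (x z))`. -/
def opD (x y : J) : Module.End ℝ J :=
  (2 : ℝ) • (mulOp x * mulOp y + mulOp (x * y) - mulOp y * mulOp x)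

variable {J} in
/-- `P_{x,y} = L_x L_y + L_y L_x - L_{x y}`. -/
def opP (x y : J) : Module.End ℝ J :=
  mulOp x * mulOp y + mulOp y * mulOp x - mulOp (x * y)

variable {J} in
theorem opD_apply (x y z : J) :
    opD x y z = (2 : ℝ) • (x * (y * z) + (x * y) * z - y * (x * z)) := by
  simp [opD, mulOp]

variable {J} in
theorem opP_apply (x y z : J) :
    opP x y z = x * (y * z) + y * (x * z) - (x * y) * z := by
  simp [opP, mulOp]

/-- The structure algebra: the span of the operators `D_{x,y}`. -/
def str : Submodule ℝ (Module.End ℝ J) :=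
  Submodule.span ℝ {T | ∃ x y : J, T = opD x y}

variable {J} in
/-- `D_{x,y}` as an element of the structure algebra. -/
def strD (x y : J) : str J := ⟨opD x y, Submodule.subset_span ⟨x, y, rfl⟩⟩

/-- The linear map `T ↦ 2 L_{T e} - T`, which sends `D_{x,y}` to `D_{y,x}`. -/
def sharpEnd : Module.End ℝ J →ₗ[ℝ] Module.End ℝ J where
  toFun T := (2 : ℝ) • mulOp (T 1) - T
  map_add' S T := by
    ext z
    simp [mulOp, add_mul]
    module
  map_smul' c T := by
    ext z
    simp [mulOp, smul_mul_assoc]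
    module

variable {J} in
theorem sharpEnd_apply (T : Module.End ℝ J) (z : J) :
    sharpEnd J T z = (2 : ℝ) • (T 1 * z) - T z := by
  simp [sharpEnd, mulOp]

variable {J} in
theorem sharpEnd_opD (x y : J) : sharpEnd J (opD x y) = opD y x := by
  ext z
  simp only [sharpEnd_apply, opD_apply, mul_one, mul_comm y x, smul_mul_assoc]
  simp only [sub_mul, add_mul]
  module

theorem sharpEnd_mem {T : Module.End ℝ J} (hT : T ∈ str J) : sharpEnd J T ∈ str J := by
  refine Submodule.span_induction (p := fun T _ => sharpEnd J T ∈ str J) ?_ ?_ ?_ ?_ hT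
  · rintro _ ⟨x, y, rfl⟩
    rw [sharpEnd_opD]
    exact (strD y x).2
  · simp
  · intro S T _ _ hS hT
    rw [map_add]
    exact add_mem hS hT
  · intro c T _ hT
    rw [map_smul]
    exact Submodule.smul_mem _ c hT

/-- The linear involution of the structure algebra with `D_{x,y} ↦ D_{y,x}`. -/
def sharp : str J →ₗ[ℝ] str J :=
  ((sharpEnd J).comp (str J).subtype).codRestrict (str J) fun T => sharpEnd_mem J T.2

variable {J} in
theorem sharp_coe (T : str J) : (sharp J T : Module.End ℝ J) = sharpEnd J T := rfl

variable {J} in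
theorem sharp_strD (x y : J) : sharp J (strD x y) = strD y x :=
  Subtype.ext (sharpEnd_opD x y)

variable {J} in
theorem opD_symm (x y z : J) : opD x y z = opD z y x := by
  simp only [opD_apply]
  rw [mul_comm (x * y) z, mul_comm x (y * z), mul_comm x z, mul_comm y x, mul_comm y z,
    mul_comm (z * y) x]
  congr 1
  abel

variable [IsCommJordan J]

variable {J} in
theorem jordan_linearised (a b d c : J) :
    a * (d * (b * c)) + b * (d * (a * c)) + ((a * b) * d) * c
      = (a * d) * (b * c) + (b * d) * (a * c) + (a * b) * (d * c) := by
  have h := two_nsmul_lie_lmul_lmul_add_add_eq_zero a b c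
  have h2 := congrArg (fun f : AddMonoid.End J => f d) h
  simp only [Ring.lie_def] at h2
  have h3 : (2 : ℝ) • ((a * ((b * c) * d) - (b * c) * (a * d)) + (b * ((c * a) * d)
      - (c * a) * (b * d)) + (c * ((a * b) * d) - (a * b) * (c * d))) = 0 := by
    rw [ofNat_smul_eq_nsmul ℝ 2]
    exact h2
  have h4 := (smul_eq_zero.mp h3).resolve_left two_ne_zero
  rw [← sub_eq_zero, ← h4]
  simp only [mul_comm]
  abel

variable {J} in
/-- `[L_u, L_v]` is a derivation. -/
theorem jordan_derivation (u v a c : J) :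
    u * (v * (a * c)) - v * (u * (a * c))
      = (u * (v * a) - v * (u * a)) * c + a * (u * (v * c) - v * (u * c)) := by
  have h1 := jordan_linearised u a v c
  have h2 := jordan_linearised v a u c
  have h3 := congrArg₂ (fun s t => s - t) h1 h2
  rw [← sub_eq_zero] at h3
  rw [sub_mul, mul_sub, ← sub_eq_zero, ← h3]
  simp only [mul_comm]
  abel

variable {J} in
theorem opD_commutator (x y u v : J) :
    opD x y * opD u v - opD u v * opD x y = opD (opD x y u) v - opD u (opD y x v) := by
  have eD : ∀ p q z : J, opD p q z
      = (2 : ℝ) • (p * (q * z) - q * (p * z)) + (2 : ℝ) • ((p * q) * z) := by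
    intro p q z
    rw [opD_apply]
    module
  have der : ∀ p q z : J, opD x y (opD p q z)
      - opD p q (opD x y z) = opD (opD x y p) q z - opD p (opD y x q) z := by
    intro p q z
    -- the derivation `δ = [L_x, L_y]`
    set δ : J → J := fun w => x * (y * w) - y * (x * w) with hδ
    have δmul : ∀ a c, δ (a * c) = δ a * c + a * δ c := fun a c => jordan_derivation x y a c
    have δadd : ∀ a c, δ (a + c) = δ a + δ c := by
      intro a c
      simp only [hδ, mul_add]
      abel
    have δsub : ∀ a c, δ (a - c) = δ a - δ c := by
      intro a c
      simp only [hδ, mul_sub]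
      abel
    have δsmul : ∀ (t : ℝ) a, δ (t • a) = t • δ a := by
      intro t a
      simp only [hδ, mul_smul_comm, smul_sub]
    have e1 : ∀ w, opD x y w = (2 : ℝ) • δ w + (2 : ℝ) • ((x * y) * w) := fun w => eD x y w
    have e2 : ∀ w, opD y x w = (2 : ℝ) • ((x * y) * w) - (2 : ℝ) • δ w := by
      intro w
      rw [eD, mul_comm y x]
      simp only [hδ]
      module
    set a := x * y
    have h1 := jordan_linearised a p z q
    have h2 := jordan_derivation p q a z
    rw [sub_mul, mul_sub] at h2
    simp only [e1, e2, eD, δmul, δadd, δsub, δsmul, mul_add, add_mul, mul_sub, sub_mul,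
      mul_smul_comm, smul_mul_assoc]
    clear_value δ a
    simp only [mul_comm] at h1 h2 ⊢
    linear_combination (norm := module) (4 : ℝ) • h1 - (4 : ℝ) • h2
  ext z
  exact der u v z

variable {J} in
theorem str_commutator {T : Module.End ℝ J} (hT : T ∈ str J) (u v : J) :
    T * opD u v - opD u v * T = opD (T u) v - opD u (sharpEnd J T v) := by
  refine Submodule.span_induction (p := fun T _ =>
    T * opD u v - opD u v * T = opD (T u) v - opD u (sharpEnd J T v)) ?_ ?_ ?_ ?_ hT
  · rintro _ ⟨x, y, rfl⟩
    rw [sharpEnd_opD]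
    exact opD_commutator x y u v
  · simp [opD]
  · intro S T _ _ hS hT
    have h : (S + T) * opD u v - opD u v * (S + T)
      = (S * opD u v - opD u v * S) + (T * opD u v - opD u v * T) := by noncomm_ring
    rw [h, hS, hT]
    ext z
    simp [opD_apply, add_mul, mul_add]
    module
  · intro c T _ hT
    have h : (c • T) * opD u v - opD u v * (c • T) = c • (T * opD u v - opD u v * T) := by
      simp [smul_sub]
    rw [h, hT]
    ext z
    simp [opD_apply, smul_mul_assoc, mul_smul_comm]
    module

variable {J} in
theorem str_commutator_mem {S T : Module.End ℝ J} (hS : S ∈ str J) (hT : T ∈ str J) :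
    S * T - T * S ∈ str J := by
  refine Submodule.span_induction (p := fun T _ => S * T - T * S ∈ str J) ?_ ?_ ?_ ?_ hT
  · rintro _ ⟨x, y, rfl⟩
    rw [str_commutator hS]
    exact sub_mem (strD _ _).2 (strD _ _).2
  · simp
  · intro A B _ _ hA hB
    have h : S * (A + B) - (A + B) * S = (S * A - A * S) + (S * B - B * S) := by noncomm_ring
    rw [h]
    exact add_mem hA hB
  · intro c A _ hA
    have h : S * (c • A) - (c • A) * S = c • (S * A - A * S) := by simp [smul_sub]
    rw [h]
    exact Submodule.smul_mem _ c hA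

variable {J} in
theorem sharpEnd_sharpEnd (T : Module.End ℝ J) : sharpEnd J (sharpEnd J T) = T := by
  ext z
  simp only [sharpEnd_apply, mul_one, sub_mul, smul_mul_assoc]
  module

variable {J} in
theorem sharpEnd_commutator {S T : Module.End ℝ J} (hS : S ∈ str J) (hT : T ∈ str J) :
    sharpEnd J (S * T - T * S)
      = sharpEnd J T * sharpEnd J S - sharpEnd J S * sharpEnd J T := by
  refine Submodule.span_induction (p := fun T _ => sharpEnd J (S * T - T * S)
      = sharpEnd J T * sharpEnd J S - sharpEnd J S * sharpEnd J T) ?_ ?_ ?_ ?_ hT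
  · rintro _ ⟨x, y, rfl⟩
    have h := str_commutator (sharpEnd_mem J hS) y x
    rw [sharpEnd_sharpEnd] at h
    rw [str_commutator hS, map_sub, sharpEnd_opD, sharpEnd_opD, sharpEnd_opD, ← neg_sub,
      ← neg_sub (_ * _), h]
  · simp
  · intro A B _ _ hA hB
    have h : S * (A + B) - (A + B) * S = (S * A - A * S) + (S * B - B * S) := by noncomm_ring
    rw [h, map_add, hA, hB, map_add]
    noncomm_ring
  · intro c A _ hA
    have h : S * (c • A) - (c • A) * S = c • (S * A - A * S) := by simp [smul_sub]
    rw [h, map_smul, hA, map_smul]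
    simp [smul_sub]

variable {J} in
/-- The commutator bracket of the structure algebra. -/
def strComm (S T : str J) : str J :=
  ⟨(S : Module.End ℝ J) * T - T * S, str_commutator_mem S.2 T.2⟩

/-- The vector space `co(J) = J ⊕ str(J) ⊕ J` underlying the Tits-Kantor-Koecher Lie algebra of
the Jordan pair `(J, J)`, with elements `(u, T, v)`. -/
def Co : Type _ := J × str J × J

instance : AddCommGroup (Co J) := inferInstanceAs (AddCommGroup (J × str J × J))

instance : Module ℝ (Co J) := inferInstanceAs (Module ℝ (J × str J × J))

namespace Co

variable {J}

/-- The element `(u, T, v)`. -/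
def mk (u : J) (T : str J) (v : J) : Co J := (u, T, v)

/-- The component in `V₊ = J`. -/
def plus (X : Co J) : J := X.1

/-- The component in the structure algebra. -/
def zero (X : Co J) : str J := X.2.1

/-- The component in `V₋ = J`. -/
def minus (X : Co J) : J := X.2.2

@[simp] theorem plus_mk (u : J) (T : str J) (v : J) : (mk u T v).plus = u := rfl
@[simp] theorem zero_mk (u : J) (T : str J) (v : J) : (mk u T v).zero = T := rfl
@[simp] theorem minus_mk (u : J) (T : str J) (v : J) : (mk u T v).minus = v := rfl
@[simp] theorem plus_add (X Y : Co J) : (X + Y).plus = X.plus + Y.plus := rfl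
@[simp] theorem zero_add' (X Y : Co J) : (X + Y).zero = X.zero + Y.zero := rfl
@[simp] theorem minus_add (X Y : Co J) : (X + Y).minus = X.minus + Y.minus := rfl
@[simp] theorem plus_smul (c : ℝ) (X : Co J) : (c • X).plus = c • X.plus := rfl
@[simp] theorem zero_smul' (c : ℝ) (X : Co J) : (c • X).zero = c • X.zero := rfl
@[simp] theorem minus_smul (c : ℝ) (X : Co J) : (c • X).minus = c • X.minus := rfl
@[simp] theorem plus_zero : (0 : Co J).plus = 0 := rfl
@[simp] theorem zero_zero' : (0 : Co J).zero = 0 := rfl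
@[simp] theorem minus_zero : (0 : Co J).minus = 0 := rfl

theorem ext_iff' {X Y : Co J} (h1 : X.plus = Y.plus)
    (h2 : (X.zero : Module.End ℝ J) = Y.zero) (h3 : X.minus = Y.minus) : X = Y :=
  Prod.ext h1 (Prod.ext (Subtype.ext h2) h3)

/-- The bracket determined by `[x, u] = D_{x,u}`, `[T, x] = T x`, `[u, D_{x,v}] = D_{v,x} u` and
the commutator bracket of the structure algebra. -/
instance : Bracket (Co J) (Co J) where
  bracket X Y := mk
    ((X.zero : Module.End ℝ J) Y.plus - (Y.zero : Module.End ℝ J) X.plus)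
    (strComm X.zero Y.zero + strD X.plus Y.minus - strD Y.plus X.minus)
    ((sharp J Y.zero : Module.End ℝ J) X.minus - (sharp J X.zero : Module.End ℝ J) Y.minus)

theorem lie_plus (X Y : Co J) : ⁅X, Y⁆.plus
    = (X.zero : Module.End ℝ J) Y.plus - (Y.zero : Module.End ℝ J) X.plus := rfl

theorem lie_zero (X Y : Co J) : (⁅X, Y⁆.zero : Module.End ℝ J)
    = (X.zero * Y.zero - Y.zero * X.zero : Module.End ℝ J)
      + opD X.plus Y.minus - opD Y.plus X.minus := rfl

theorem lie_minus (X Y : Co J) : ⁅X, Y⁆.minus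
    = sharpEnd J Y.zero X.minus - sharpEnd J X.zero Y.minus := rfl

theorem lie_sharp (X Y : Co J) : sharpEnd J ⁅X, Y⁆.zero
    = sharpEnd J Y.zero * sharpEnd J X.zero - sharpEnd J X.zero * sharpEnd J Y.zero
      + opD Y.minus X.plus - opD X.minus Y.plus := by
  rw [lie_zero, map_sub, map_add, sharpEnd_commutator X.zero.2 Y.zero.2, sharpEnd_opD,
    sharpEnd_opD]

theorem opD_sub_left (x x' y : J) : opD (x - x') y = opD x y - opD x' y := by
  ext z
  simp only [opD_apply, sub_mul, mul_sub, LinearMap.sub_apply]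
  module

theorem opD_sub_right (x y y' : J) : opD x (y - y') = opD x y - opD x y' := by
  ext z
  simp only [opD_apply, sub_mul, mul_sub, LinearMap.sub_apply]
  module

instance : LieRing (Co J) where
  add_lie X Y Z := by
    refine ext_iff' ?_ ?_ ?_
    · simp only [lie_plus, plus_add, zero_add', Submodule.coe_add, LinearMap.add_apply, map_add]
      abel
    · ext z
      simp [lie_zero, opD_apply, add_mul, mul_add]
      module
    · simp only [lie_minus, minus_add, zero_add', Submodule.coe_add, LinearMap.add_apply, map_add]
      abel
  lie_add X Y Z := by
    refine ext_iff' ?_ ?_ ?_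
    · simp only [lie_plus, plus_add, zero_add', Submodule.coe_add, LinearMap.add_apply, map_add]
      abel
    · ext z
      simp [lie_zero, opD_apply, add_mul, mul_add]
      module
    · simp only [lie_minus, minus_add, zero_add', Submodule.coe_add, LinearMap.add_apply, map_add]
      abel
  lie_self X := by
    refine ext_iff' ?_ ?_ ?_
    · simp [lie_plus]
    · simp [lie_zero]
    · simp [lie_minus]
  leibniz_lie X Y Z := by
    refine ext_iff' ?_ ?_ ?_
    · simp only [lie_plus, plus_add, lie_zero, LinearMap.add_apply, LinearMap.sub_apply,
        Module.End.mul_apply, map_sub]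
      rw [opD_symm Y.plus Z.minus X.plus, opD_symm Z.plus Y.minus X.plus,
        opD_symm Z.plus X.minus Y.plus]
      abel
    · have h1 := str_commutator X.zero.2 Y.plus Z.minus
      have h2 := str_commutator X.zero.2 Z.plus Y.minus
      have h3 := str_commutator Y.zero.2 X.plus Z.minus
      have h4 := str_commutator Y.zero.2 Z.plus X.minus
      have h5 := str_commutator Z.zero.2 X.plus Y.minus
      have h6 := str_commutator Z.zero.2 Y.plus X.minus
      simp only [lie_zero, lie_plus, lie_minus, Submodule.coe_add, zero_add', opD_sub_left,
        opD_sub_right]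
      linear_combination (norm := noncomm_ring) h1 - h2 - h3 + h4 + h5 - h6
    · simp only [lie_minus, minus_add, lie_sharp, map_sub, LinearMap.add_apply,
        LinearMap.sub_apply, Module.End.mul_apply]
      rw [opD_symm Z.minus Y.plus X.minus, opD_symm Z.minus X.plus Y.minus,
        opD_symm Y.minus Z.plus X.minus]
      abel

instance : LieAlgebra ℝ (Co J) where
  lie_smul c X Y := by
    refine ext_iff' ?_ ?_ ?_
    · simp [lie_plus, smul_sub]
    · ext z
      simp [lie_zero, opD_apply, smul_mul_assoc, mul_smul_comm]
      module
    · simp [lie_minus, smul_sub]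

end Co

end Algebra

/-! ### Three-graded Lie algebras and their polynomial realisations -/

/-- A grading `L = L₁ ⊕ L₀ ⊕ L₋₁` of a real Lie algebra. -/
structure ThreeGrading (L : Type*) [LieRing L] [LieAlgebra ℝ L] where
  plus : Submodule ℝ L
  zero : Submodule ℝ L
  minus : Submodule ℝ L
  existsUnique_decomposition :
    ∀ X : L, ∃! p : plus × zero × minus, (p.1 : L) + (p.2.1 : L) + (p.2.2 : L) = X
  lie_plus_plus : ∀ X ∈ plus, ∀ Y ∈ plus, ⁅X, Y⁆ = 0
  lie_zero_plus : ∀ X ∈ zero, ∀ Y ∈ plus, ⁅X, Y⁆ ∈ plus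
  lie_plus_minus : ∀ X ∈ plus, ∀ Y ∈ minus, ⁅X, Y⁆ ∈ zero
  lie_zero_zero : ∀ X ∈ zero, ∀ Y ∈ zero, ⁅X, Y⁆ ∈ zero
  lie_zero_minus : ∀ X ∈ zero, ∀ Y ∈ minus, ⁅X, Y⁆ ∈ minus
  lie_minus_minus : ∀ X ∈ minus, ∀ Y ∈ minus, ⁅X, Y⁆ = 0

namespace ThreeGrading

variable {L : Type*} [LieRing L] [LieAlgebra ℝ L] (G : ThreeGrading L)

/-- The bracket `L₁ × L₋₁ → L₀`. -/
def lieZero (X : G.plus) (Y : G.minus) : G.zero :=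
  ⟨⁅(X : L), (Y : L)⁆, G.lie_plus_minus X X.2 Y Y.2⟩

/-- The bracket `L₀ × L₋₁ → L₋₁`. -/
def lieMinus (X : G.zero) (Y : G.minus) : G.minus :=
  ⟨⁅(X : L), (Y : L)⁆, G.lie_zero_minus X X.2 Y Y.2⟩

/-- A character of the Lie algebra `L₀`. -/
structure Character where
  toLinearMap : G.zero →ₗ[ℝ] ℝ
  map_lie : ∀ X Y : G.zero,
    toLinearMap ⟨⁅(X : L), (Y : L)⁆, G.lie_zero_zero X X.2 Y Y.2⟩ = 0

end ThreeGrading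

/-- Multiplication by a vector `v` on the symmetric algebra `S(V)`. -/
noncomputable def symMul {V : Type*} [AddCommGroup V] [Module ℝ V] (v : V) :
    Module.End ℝ (SymmetricAlgebra ℝ V) :=
  LinearMap.mulLeft ℝ (SymmetricAlgebra.ι ℝ V v)

/-- The derivation `∂ⁱ` of `S(V)` with `∂ⁱ X_j = δ_{ij}`, for a basis `(X_j)` of `V`. -/
noncomputable def symPartial {V : Type*} [AddCommGroup V] [Module ℝ V] {m : ℕ}
    (b : Module.Basis (Fin m) ℝ V) (i : Fin m) : Module.End ℝ (SymmetricAlgebra ℝ V) :=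
  (SymmetricAlgebra.equivMvPolynomial b).symm.toLinearMap ∘ₗ
    (MvPolynomial.pderiv i : Derivation ℝ (MvPolynomial (Fin m) ℝ) (MvPolynomial (Fin m) ℝ)) ∘ₗ
    (SymmetricAlgebra.equivMvPolynomial b).toLinearMap

/-- `π` is the realisation of the 3-graded Lie algebra `L` by polynomial differential operators
on `S(L₋₁)` attached to the character `χ` of `L₀`:
`π(X) = X` for `X ∈ L₋₁`, `π(X) = χ(X) + ∑ᵢ [X, Xᵢ] ∂ⁱ` for `X ∈ L₀` and
`π(X) = ∑ᵢ χ([X, Xᵢ]) ∂ⁱ + ½ ∑ᵢⱼ [[X, Xᵢ], Xⱼ] ∂ʲ ∂ⁱ` for `X ∈ L₁`, in any basis `(Xᵢ)` of `L₋₁`. -/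
structure IsThreeGradedRealisation {L : Type*} [LieRing L] [LieAlgebra ℝ L] (G : ThreeGrading L)
    (χ : G.Character) (π : L →ₗ⁅ℝ⁆ Module.End ℝ (SymmetricAlgebra ℝ G.minus)) : Prop where
  apply_minus : ∀ X : G.minus, π (X : L) = symMul X
  apply_zero : ∀ (m : ℕ) (b : Module.Basis (Fin m) ℝ G.minus) (X : G.zero),
    π (X : L) = χ.toLinearMap X • (1 : Module.End ℝ (SymmetricAlgebra ℝ G.minus))
      + ∑ i, symMul (G.lieMinus X (b i)) * symPartial b i
  apply_plus : ∀ (m : ℕ) (b : Module.Basis (Fin m) ℝ G.minus) (X : G.plus),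
    π (X : L) = ∑ i, χ.toLinearMap (G.lieZero X (b i)) • symPartial b i
      + (1 / 2 : ℝ) • ∑ i, ∑ j,
          symMul (G.lieMinus (G.lieZero X (b i)) (b j)) * (symPartial b j * symPartial b i)

/-! ### Rank, trace form and Cartan involutions -/

section Trace

variable (J : Type*) [NonAssocCommRing J] [Module ℝ J] [IsScalarTower ℝ J J]
  [SMulCommClass ℝ J J]

variable {J} in
/-- The degree of the minimal polynomial of `x`, which is the dimension of the span of the powers
`e, x, x², …`, where `xᵏ = L_xᵏ e`. -/
noncomputable def minDegree (x : J) : ℕ :=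
  Module.finrank ℝ (Submodule.span ℝ (Set.range fun k : ℕ => ((mulOp x) ^ k) (1 : J)))

/-- The rank: the maximal degree of the minimal polynomial of an element. -/
noncomputable def rank : ℕ := sSup (Set.range (minDegree : J → ℕ))

variable {J} in
/-- `x` is regular if its minimal polynomial has maximal degree. -/
def IsRegularElt (x : J) : Prop := minDegree x = rank J

/-- `t` is the Jordan trace: `-t(x)` is the coefficient of `X^{r-1}` in the minimal polynomial
`p` of each regular element `x`, where `r` is the rank. -/
def IsJordanTrace (t : J →ₗ[ℝ] ℝ) : Prop :=
  ∀ x : J, IsRegularElt x → ∀ p : Polynomial ℝ, p.Monic → p.natDegree = rank J →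
    (Polynomial.aeval (mulOp x) p) (1 : J) = 0 → t x = -p.coeff (rank J - 1)

open Classical in
/-- The Jordan trace. On a finite-dimensional unital Jordan algebra it exists, and it is unique
since the regular elements are dense. -/
noncomputable def jordanTrace : J →ₗ[ℝ] ℝ :=
  if h : ∃ t : J →ₗ[ℝ] ℝ, IsJordanTrace J t then h.choose else 0

/-- The trace form `τ(x, y) = tr(x y)`. -/
noncomputable def traceForm : LinearMap.BilinForm ℝ J :=
  (LinearMap.mul ℝ J).compr₂ (jordanTrace J)

variable {J} in
theorem traceForm_comm (x y : J) : traceForm J x y = traceForm J y x := by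
  simp [traceForm, mul_comm x y]

variable {J} in
/-- A Cartan involution: an involutive automorphism `α` such that `(x|y) = τ(x, α y)` is positive
definite. -/
structure IsCartanInvolution (α : J →ₙₐ[ℝ] J) : Prop where
  involutive : ∀ x, α (α x) = x
  posDef : ∀ x, x ≠ 0 → 0 < traceForm J x (α x)

variable {J} in
/-- The form `(x|y) = τ(x, α y)`. -/
noncomputable def cartanForm (α : J →ₙₐ[ℝ] J) (x y : J) : ℝ := traceForm J x (α y)

variable {J} in
/-- The subalgebra of fixed points of `α`. -/
def fixedPoints (α : J →ₙₐ[ℝ] J) : NonUnitalSubalgebra ℝ J :=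
  NonUnitalAlgHom.equalizer α (NonUnitalAlgHom.id ℝ J)

variable {J} in
theorem IsCartanInvolution.nondegenerate {α : J →ₙₐ[ℝ] J} (hα : IsCartanInvolution α) :
    (traceForm J).Nondegenerate := by
  have h : ∀ x : J, (∀ y, traceForm J x y = 0) → x = 0 := by
    intro x hx
    by_contra hne
    exact (hα.posDef x hne).ne' (hx _)
  exact ⟨h, fun y hy => h y fun x => (traceForm_comm y x).trans (hy x)⟩

variable {J} in
/-- The basis `(ēᵢ)` with `τ(eᵢ, ēⱼ) = δᵢⱼ`. -/
noncomputable def IsCartanInvolution.dual {α : J →ₙₐ[ℝ] J} (hα : IsCartanInvolution α)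
    {m : ℕ} (e : Module.Basis (Fin m) ℝ J) : Module.Basis (Fin m) ℝ J :=
  (traceForm J).dualBasis hα.nondegenerate e

end Trace

/-! ### The standard grading of `co(J)` and the trace characters -/

section CoGrading

variable (J : Type*) [NonAssocCommRing J] [Module ℝ J] [IsScalarTower ℝ J J]
  [SMulCommClass ℝ J J] [IsCommJordan J]

/-- The grading of `co(J) = J ⊕ str(J) ⊕ J`. -/
def coGrading : ThreeGrading (Co J) where
  plus := {
    carrier := {X | X.zero = 0 ∧ X.minus = 0}
    add_mem' := fun {X Y} hX hY => by simp_all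
    zero_mem' := by simp
    smul_mem' := fun c X hX => by simp_all }
  zero := {
    carrier := {X | X.plus = 0 ∧ X.minus = 0}
    add_mem' := fun {X Y} hX hY => by simp_all
    zero_mem' := by simp
    smul_mem' := fun c X hX => by simp_all }
  minus := {
    carrier := {X | X.plus = 0 ∧ X.zero = 0}
    add_mem' := fun {X Y} hX hY => by simp_all
    zero_mem' := by simp
    smul_mem' := fun c X hX => by simp_all }
  existsUnique_decomposition X := by
    refine ⟨⟨⟨Co.mk X.plus 0 0, by simp⟩, ⟨Co.mk 0 X.zero 0, by simp⟩,
      ⟨Co.mk 0 0 X.minus, by simp⟩⟩, ?_, ?_⟩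
    · exact Co.ext_iff' (by simp) (by simp) (by simp)
    · rintro ⟨⟨A, hA1, hA2⟩, ⟨B, hB1, hB2⟩, ⟨C, hC1, hC2⟩⟩ rfl
      simp only [Prod.mk.injEq, Subtype.mk.injEq]
      refine ⟨Co.ext_iff' ?_ ?_ ?_, Co.ext_iff' ?_ ?_ ?_, Co.ext_iff' ?_ ?_ ?_⟩ <;> simp_all
  lie_plus_plus := by
    rintro X ⟨hX1, hX2⟩ Y ⟨hY1, hY2⟩
    exact Co.ext_iff' (by simp [Co.lie_plus, *]) (by simp [Co.lie_zero, opD, *])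
      (by simp [Co.lie_minus, *])
  lie_zero_plus := by
    rintro X ⟨hX1, hX2⟩ Y ⟨hY1, hY2⟩
    exact ⟨Subtype.ext (by simp [Co.lie_zero, opD, *]), by simp [Co.lie_minus, *]⟩
  lie_plus_minus := by
    rintro X ⟨hX1, hX2⟩ Y ⟨hY1, hY2⟩
    exact ⟨by simp [Co.lie_plus, *], by simp [Co.lie_minus, *]⟩
  lie_zero_zero := by
    rintro X ⟨hX1, hX2⟩ Y ⟨hY1, hY2⟩
    exact ⟨by simp [Co.lie_plus, *], by simp [Co.lie_minus, *]⟩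
  lie_zero_minus := by
    rintro X ⟨hX1, hX2⟩ Y ⟨hY1, hY2⟩
    exact ⟨by simp [Co.lie_plus, *], Subtype.ext (by simp [Co.lie_zero, opD, *])⟩
  lie_minus_minus := by
    rintro X ⟨hX1, hX2⟩ Y ⟨hY1, hY2⟩
    exact Co.ext_iff' (by simp [Co.lie_plus, *]) (by simp [Co.lie_zero, opD, *])
      (by simp [Co.lie_minus, *])

/-- The character `λ(T) = -(r / 2n) λ₀ Tr(T)` of `str(J)`, with `r` the rank and `n` the dimension
of `J`. -/
noncomputable def traceCharacter (lam : ℝ) : (coGrading J).Character where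
  toLinearMap :=
    { toFun := fun X => -((rank J : ℝ) / (2 * Module.finrank ℝ J)) * lam *
        LinearMap.trace ℝ J ((X : Co J).zero : Module.End ℝ J)
      map_add' := fun X Y => by simp [mul_add]
      map_smul' := fun c X => by simp; ring }
  map_lie := by
    rintro ⟨X, hX1, hX2⟩ ⟨Y, hY1, hY2⟩
    simp only [LinearMap.coe_mk, AddHom.coe_mk, Co.lie_zero, hX1, hY1]
    simp [opD, LinearMap.trace_mul_comm ℝ (X.zero : Module.End ℝ J)]

end CoGrading

/-! ### Smooth functions on `J` and Bessel operators -/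

section Smooth

variable (J : Type*) [NonAssocCommRing J] [Module ℝ J] [IsScalarTower ℝ J J]
  [SMulCommClass ℝ J J]

/-- The smooth functions `J → 𝕜`: those that are smooth in linear coordinates. -/
def SmoothFun (𝕜 : Type*) [NormedField 𝕜] [NormedAlgebra ℝ 𝕜] : Subalgebra 𝕜 (J → 𝕜) where
  carrier := {f | ∀ c : (Fin (Module.finrank ℝ J) → ℝ) ≃ₗ[ℝ] J, ContDiff ℝ ∞ fun y => f (c y)}
  mul_mem' hf hg c := (hf c).mul (hg c)
  add_mem' hf hg c := (hf c).add (hg c)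
  algebraMap_mem' _ _ := contDiff_const

/-- A linear form on `J`, as a smooth function. -/
def linearFun : (J →ₗ[ℝ] ℝ) →ₗ[ℝ] SmoothFun J ℝ where
  toFun φ := ⟨φ, fun c => (LinearMap.toContinuousLinearMap (φ ∘ₗ c.toLinearMap)).contDiff⟩
  map_add' _ _ := rfl
  map_smul' _ _ := rfl

/-- The homomorphism of algebras `S(co(J)₋₁) → C^∞(J)` that extends `v ↦ τ(v, ·)`, for
`v ∈ J ≅ co(J)₋₁`. -/
noncomputable def traceIdent [IsCommJordan J] :
    SymmetricAlgebra ℝ (coGrading J).minus →ₐ[ℝ] SmoothFun J ℝ :=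
  SymmetricAlgebra.lift
    { toFun := fun X => linearFun J (traceForm J (X : Co J).minus)
      map_add' := fun X Y => by simp
      map_smul' := fun c X => by simp }

variable {J} in
/-- The derivative of `f` in the direction `w`. -/
noncomputable def dirDeriv {𝕜 : Type*} [NormedField 𝕜] [NormedAlgebra ℝ 𝕜] (w : J) (f : J → 𝕜) :
    J → 𝕜 := fun x => lineDeriv ℝ f x w

variable {J} in
/-- The classical Bessel operator
`B_λ f(x) = ∑ᵢⱼ (∂²f/∂xᵢ∂xⱼ)(x) P(ēᵢ, ēⱼ) x + λ ∑ᵢ (∂f/∂xᵢ)(x) ēᵢ`, where `x = ∑ᵢ xᵢ bᵢ` and `(ēᵢ)`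
is the basis with `τ(bᵢ, ēⱼ) = δᵢⱼ`. -/
noncomputable def besselOperator {α : J →ₙₐ[ℝ] J} (hα : IsCartanInvolution α) (lam : ℝ) {m : ℕ}
    (b : Module.Basis (Fin m) ℝ J) (f : J → ℝ) (x : J) : J :=
  ∑ i, ∑ j, dirDeriv (b i) (dirDeriv (b j) f) x • opP (hα.dual b i) (hα.dual b j) x
    + lam • ∑ i, dirDeriv (b i) f x • hα.dual b i

end Smooth

end JordanBessel

open JordanBessel

namespace JordanBessel

/-! ### Integrals depending on a parameter and Hadamard's lemma -/

section Analysis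

open MeasureTheory intervalIntegral

/-! The representation is built once, in an abstract setting. Let a commutative algebra `A` carry
multiplications by `μ v` and operators `d w` with `d w 1 = 0` and `[d w, μ v] = B v w`, and suppose
that an operator on `A` that commutes with every `μ v` and kills `1` is zero (`rigid`). An operator
is then known from its commutators with the `μ v` and from its value at `1`. The operators of `V₊`
and `str(J)` satisfy `[P_x, μ v] = O_{D_{x,v}}` and `[O_T, μ v] = -μ(T♯ v)`, where `D_{x,y}♯ =
D_{y,x}`. So each bracket relation, commuted with `μ v`, becomes a relation one degree lower: `[O,
O]` needs only that `♯` reverses commutators, `[O, P]` needs `[O, O]`, and `[P, P] = 0` needs `[O,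
P]` and the symmetry of the triple product. Rigidity also gives independence of the basis and the
intertwining by `traceIdent`.

There are two models. On `S(V₋)` rigidity holds because `V₋` generates. On `C^∞(J)` it is Hadamard's
lemma: up to a constant, `f` is a combination of linear forms vanishing at `x`, minus nothing else,
so the value at `x` of the image of `f` is determined.

The Bessel operator appears through two facts on the trace form. It is associative: the Jordan trace
is invariant under automorphisms, hence kills derivations, in particular `[L_x, L_z]`. And `Tr
D_{x,y} = (2n/r) τ(x,y)`: the form `Tr L_{xy}` is associative too, so its ratio to `τ` commutes with
all multiplications; it is self-adjoint for `(·|·)`, so it has a real eigenspace, which is an ideal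
and hence everything. Evaluation at the unit, where `tr e = r`, gives the scalar `n/r`.

Finally `π'` is the twist by `(u,T,v) ↦ (-αv, -αT♯α, -αu)`. The passage to `ρ` is legitimate because
`(-i)·i = 1` and `V₊`, `V₋` are abelian. -/

theorem differentiable_intervalIntegral_of_contDiff {E F : Type*} [NormedAddCommGroup E] [NormedSpace ℝ E]
    [FiniteDimensional ℝ E] [NormedAddCommGroup F] [NormedSpace ℝ F] (g : E × ℝ → F)
    (hg : ContDiff ℝ ∞ g) : Differentiable ℝ (fun y => ∫ t in (0 : ℝ)..1, g (y, t)) ∧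
      ∀ y, fderiv ℝ (fun y => ∫ t in (0 : ℝ)..1, g (y, t)) y
        = ∫ t in (0 : ℝ)..1, (fderiv ℝ g (y, t)).comp (ContinuousLinearMap.inl ℝ E ℝ) := by
  set g' : E → ℝ → E →L[ℝ] F :=
    fun y t => (fderiv ℝ g (y, t)).comp (ContinuousLinearMap.inl ℝ E ℝ) with hg'
  have hcont : Continuous (Function.uncurry g') := by
    have := hg.continuous_fderiv (by simp)
    simp only [hg', Function.uncurry_def]
    fun_prop
  have hgc := hg.continuous
  have key : ∀ y, HasFDerivAt (fun y => ∫ t in (0 : ℝ)..1, g (y, t))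
      (∫ t in (0 : ℝ)..1, g' y t) y := by
    intro y
    -- The partial derivative is continuous, hence bounded on a compact set; the constant `C` is the
    -- dominating function.
    obtain ⟨C, hC⟩ := ((isCompact_closedBall y 1).prod (isCompact_Icc (a := (0 : ℝ)) (b := 1))
      ).exists_bound_of_continuousOn hcont.continuousOn
    refine hasFDerivAt_integral_of_dominated_of_fderiv_le (s := Metric.ball y 1)
      (bound := fun _ => C) (F := fun y t => g (y, t)) (F' := g')
      (Metric.ball_mem_nhds y one_pos) ?_ ?_ ?_ ?_ ?_ ?_
    · exact Filter.Eventually.of_forall fun x =>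
        (show Continuous fun t => g (x, t) by fun_prop).aestronglyMeasurable
    · exact (show Continuous fun t => g (y, t) by fun_prop).intervalIntegrable _ _
    · exact (show Continuous fun t => g' y t from
        hcont.comp (Continuous.prodMk continuous_const continuous_id)).aestronglyMeasurable
    · refine Filter.Eventually.of_forall fun t ht x hx => hC (x, t) ⟨?_, ?_⟩
      · exact Metric.ball_subset_closedBall hx
      · rw [Set.uIoc_of_le zero_le_one] at ht
        exact ⟨ht.1.le, ht.2⟩
    · exact intervalIntegrable_const
    · refine Filter.Eventually.of_forall fun t _ x _ => ?_
      have h1 : HasFDerivAt g (fderiv ℝ g (x, t)) (x, t) :=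
        (hg.differentiable (by simp) _).hasFDerivAt
      exact h1.comp x (hasFDerivAt_prodMk_left x t)
  exact ⟨fun y => (key y).differentiableAt, fun y => (key y).fderiv⟩

/-- Induction on the order. The target `F` varies inside the induction because the derivative takes
values in `E →L[ℝ] F`; fixing `E : Type` keeps that space in the universe of `F`. -/
theorem contDiff_intervalIntegral {E : Type} [NormedAddCommGroup E] [NormedSpace ℝ E]
    [FiniteDimensional ℝ E] (n : ℕ) : ∀ {F : Type} [NormedAddCommGroup F] [NormedSpace ℝ F]
    (g : E × ℝ → F), ContDiff ℝ ∞ g → ContDiff ℝ n (fun y => ∫ t in (0 : ℝ)..1, g (y, t)) := by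
  induction n with
  | zero =>
    intro F _ _ g hg
    exact contDiff_zero.mpr (differentiable_intervalIntegral_of_contDiff g hg).1.continuous
  | succ n ih =>
    intro F _ _ g hg
    have h := differentiable_intervalIntegral_of_contDiff g hg
    have : ((n + 1 : ℕ) : WithTop ℕ∞) = (n : WithTop ℕ∞) + 1 := by norm_cast
    rw [this, contDiff_succ_iff_fderiv]
    refine ⟨h.1, by simp, ?_⟩
    rw [funext h.2]
    refine ih (fun p => (fderiv ℝ g p).comp (ContinuousLinearMap.inl ℝ E ℝ)) ?_
    exact (hg.fderiv_right (by simp)).clm_comp contDiff_const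

/-- Hadamard's lemma. -/
theorem exists_contDiff_sub_eq_sum {n : ℕ} (f : (Fin n → ℝ) → ℝ) (hf : ContDiff ℝ ∞ f)
    (x : Fin n → ℝ) : ∃ g : Fin n → (Fin n → ℝ) → ℝ, (∀ i, ContDiff ℝ ∞ (g i)) ∧
      ∀ y, f y = f x + ∑ i, (y i - x i) * g i y := by
  have hfd : ContDiff ℝ ∞ (fderiv ℝ f) := hf.fderiv_right (by simp)
  -- The fundamental theorem of calculus along the segment from `x` to `y`, with the derivative
  -- split into partial derivatives.
  refine ⟨fun i y => ∫ t in (0 : ℝ)..1, fderiv ℝ f (x + t • (y - x)) (Pi.single i 1), ?_, ?_⟩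
  · intro i
    refine contDiff_infty.mpr fun k => contDiff_intervalIntegral k
      (fun p : (Fin n → ℝ) × ℝ => fderiv ℝ f (x + p.2 • (p.1 - x)) (Pi.single i 1)) ?_
    fun_prop
  · intro y
    have hd : ∀ t : ℝ, HasDerivAt (fun t : ℝ => f (x + t • (y - x)))
        (fderiv ℝ f (x + t • (y - x)) (y - x)) t := by
      intro t
      have h1 : HasDerivAt (fun t : ℝ => x + t • (y - x)) (y - x) t := by
        simpa using ((hasDerivAt_id t).smul_const (y - x)).const_add x
      exact (hf.differentiable (by simp) _).hasFDerivAt.comp_hasDerivAt t h1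
    have hc := hfd.continuous
    have h2 := integral_eq_sub_of_hasDerivAt (a := 0) (b := 1) (fun t _ => hd t)
      (Continuous.intervalIntegrable (by fun_prop) _ _)
    simp only [one_smul, add_sub_cancel, zero_smul, add_zero] at h2
    rw [← sub_eq_iff_eq_add', ← h2]
    simp_rw [← intervalIntegral.integral_const_mul]
    rw [← intervalIntegral.integral_finsetSum]
    · refine integral_congr fun t _ => ?_
      have h3 : y - x = ∑ i, (y i - x i) • (Pi.single i 1 : Fin n → ℝ) := by
        ext j
        simp [Finset.sum_apply, Pi.single_apply]
      conv_lhs => rw [h3, map_sum]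
      -- The expansion has also rewritten `y - x` in the base point of the derivative; this undoes
      -- it there.
      rw [← h3]
      simp only [map_smul, smul_eq_mul]
    · intro i _
      exact Continuous.intervalIntegrable (by fun_prop) _ _

end Analysis

/-! ### Derivations as infinitesimal automorphisms -/

section Automorphisms

variable {E : Type*} [NormedAddCommGroup E] [NormedSpace ℝ E] [FiniteDimensional ℝ E]

/-- A linear form that is invariant under the automorphisms of a bilinear product vanishes on
the images of its derivations. -/
theorem invariant_form_apply_derivation (B : E →ₗ[ℝ] E →ₗ[ℝ] E) (D : E →ₗ[ℝ] E)
    (hD : ∀ x y, D (B x y) = B (D x) y + B x (D y)) (t : E →ₗ[ℝ] ℝ)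
    (ht : ∀ φ : E ≃ₗ[ℝ] E, (∀ x y, φ (B x y) = B (φ x) (φ y)) → ∀ x, t (φ x) = t x) (z : E) :
    t (D z) = 0 := by
  let _ : NormedAlgebra ℚ (E →L[ℝ] E) := NormedAlgebra.restrictScalars ℚ ℝ (E →L[ℝ] E)
  let D' : E →L[ℝ] E := D.toContinuousLinearMap
  let B' : E →L[ℝ] E →L[ℝ] E := B.toContinuousBilinearMap
  have hexp : ∀ s : ℝ, HasDerivAt (fun s : ℝ => NormedSpace.exp (s • D'))
    (D' * NormedSpace.exp (s • D')) s := fun s => hasDerivAt_exp_smul_const' D' s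
  have hinv : ∀ s : ℝ, NormedSpace.exp (s • D') * NormedSpace.exp ((-s) • D') = 1 := by
    intro s
    rw [← NormedSpace.exp_add_of_commute (((Commute.refl D').smul_left _).smul_right _),
      ← add_smul]
    simp
  have hv : ∀ (s : ℝ) (x : E), HasDerivAt (fun s : ℝ => NormedSpace.exp (s • D') x)
      (D (NormedSpace.exp (s • D') x)) s := by
    intro s x
    exact (hexp s).clm_apply (hasDerivAt_const s x) |>.congr_deriv (by simp [D'])
  have hneg : ∀ s : ℝ, HasDerivAt (fun s : ℝ => NormedSpace.exp ((-s) • D'))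
      (-(NormedSpace.exp ((-s) • D') * D')) s := by
    intro s
    have h1 := (hasDerivAt_exp_smul_const D' (-s)).scomp s (hasDerivAt_neg s)
    exact h1.congr_deriv (by simp)
  have hmul : ∀ (s : ℝ) (x y : E), NormedSpace.exp (s • D') (B x y)
      = B (NormedSpace.exp (s • D') x) (NormedSpace.exp (s • D') y) := by
    intro s x y
    -- Undoing the flow after the product gives a curve that starts at `B x y`; the Leibniz rule
    -- makes its derivative vanish, so `exp (s D)` respects the product.
    let g : ℝ → E := fun s => NormedSpace.exp ((-s) • D')
      (B' (NormedSpace.exp (s • D') x) (NormedSpace.exp (s • D') y))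
    have hg : ∀ s, HasDerivAt g 0 s := by
      intro s
      have h1 : HasDerivAt (fun s => B' (NormedSpace.exp (s • D') x)) _ s :=
        B'.hasFDerivAt.comp_hasDerivAt s (hv s x)
      have h2 := h1.clm_apply (hv s y)
      refine ((hneg s).clm_apply h2).congr_deriv ?_
      have h3 := hD (NormedSpace.exp (s • D') x) (NormedSpace.exp (s • D') y)
      rw [neg_apply]
      rw [neg_add_eq_zero]
      exact congrArg _ h3
    have hconst := is_const_of_deriv_eq_zero (fun s => (hg s).differentiableAt)
      (fun s => (hg s).deriv) s 0
    simp only [g, neg_zero, zero_smul, NormedSpace.exp_zero, one_apply_eq_self]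
      at hconst
    have h4 := congrArg (fun v => (NormedSpace.exp (s • D') : E →L[ℝ] E) v) hconst
    have h5 := fun v : E => congrArg (fun A : E →L[ℝ] E => A v) (hinv s)
    simp only [mul_apply_eq_comp, one_apply_eq_self] at h5
    exact h4.symm.trans (h5 _)
  have hφ : ∀ (s : ℝ) (x : E), t (NormedSpace.exp (s • D') x) = t x := by
    intro s x
    let φ : E ≃ₗ[ℝ] E := LinearEquiv.ofLinearMap (NormedSpace.exp (s • D') : E →L[ℝ] E).toLinearMap
      (NormedSpace.exp ((-s) • D') : E →L[ℝ] E).toLinearMap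
      (by
        ext v
        exact congrArg (fun A : E →L[ℝ] E => A v) (hinv s))
      (by
        ext v
        have := hinv (-s)
        rw [neg_neg] at this
        exact congrArg (fun A : E →L[ℝ] E => A v) this)
    exact ht φ (hmul s) x
  have h5 : HasDerivAt (fun s : ℝ => t.toContinuousLinearMap (NormedSpace.exp (s • D') z)) _ 0 :=
    t.toContinuousLinearMap.hasFDerivAt.comp_hasDerivAt 0 (hv 0 z)
  have h6 : (fun s : ℝ => t.toContinuousLinearMap (NormedSpace.exp (s • D') z))
      = fun _ => t z := funext fun s => hφ s z
  -- The function is constant by invariance, so its derivative `t (D z)` at `0` vanishes.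
  rw [h6] at h5
  have h7 := h5.unique (hasDerivAt_const 0 (t z))
  simpa using h7

end Automorphisms

/-! ### Cyclic subspaces and characteristic polynomials -/

section Cyclic

variable {V : Type*} [AddCommGroup V] [Module ℝ V]

/-- The span of the vectors `Aᵏ v`. -/
def cyclicSpan (A : Module.End ℝ V) (v : V) : Submodule ℝ V :=
  Submodule.span ℝ (Set.range fun k : ℕ => (A ^ k) v)

theorem mem_cyclicSpan_self (A : Module.End ℝ V) (v : V) : v ∈ cyclicSpan A v :=
  Submodule.subset_span ⟨0, rfl⟩

theorem apply_mem_cyclicSpan (A : Module.End ℝ V) (v : V) {w : V} (hw : w ∈ cyclicSpan A v) :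
    A w ∈ cyclicSpan A v := by
  refine Submodule.span_induction (p := fun w _ => A w ∈ cyclicSpan A v) ?_ ?_ ?_ ?_ hw
  · rintro _ ⟨k, rfl⟩
    exact Submodule.subset_span ⟨k + 1, by simp [pow_succ']⟩
  · simp
  · intro a b _ _ ha hb
    rw [map_add]
    exact add_mem ha hb
  · intro c a _ ha
    rw [map_smul]
    exact Submodule.smul_mem _ c ha

theorem cyclicSpan_le {A : Module.End ℝ V} {v : V} {W : Submodule ℝ V} (hv : v ∈ W)
    (hA : ∀ w ∈ W, A w ∈ W) : cyclicSpan A v ≤ W := by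
  refine Submodule.span_le.mpr ?_
  rintro _ ⟨k, rfl⟩
  induction k with
  | zero => simpa using hv
  | succ k ih => simpa [pow_succ'] using hA _ ih

/-- `A` and `A + c` have the same invariant subspaces. This shows that `x` and `x + e` have minimal
polynomials of the same degree. -/
theorem cyclicSpan_add_smul_one (A : Module.End ℝ V) (v : V) (c : ℝ) :
    cyclicSpan (A + c • 1) v = cyclicSpan A v := by
  have key : ∀ (B : Module.End ℝ V) (d : ℝ), cyclicSpan (B + d • 1) v ≤ cyclicSpan B v :=
    fun B d => cyclicSpan_le (mem_cyclicSpan_self B v) fun w hw =>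
      add_mem (apply_mem_cyclicSpan B v hw) (Submodule.smul_mem _ d hw)
  refine le_antisymm (key A c) ?_
  have := key (A + c • 1) (-c)
  rwa [neg_smul, add_neg_cancel_right] at this

/-- Cayley-Hamilton on `W`. On the cyclic span of a regular element it yields an annihilating
polynomial of degree equal to the rank. -/
theorem aeval_charpoly_restrict [FiniteDimensional ℝ V] (A : Module.End ℝ V) {W : Submodule ℝ V}
    (hA : ∀ w ∈ W, A w ∈ W) {v : V} (hv : v ∈ W) :
    Polynomial.aeval A (A.restrict hA).charpoly v = 0 := by
  have h : ∀ (p : Polynomial ℝ) (w : W),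
      ((Polynomial.aeval (A.restrict hA) p w : W) : V) = Polynomial.aeval A p w := by
    intro p w
    induction p using Polynomial.induction_on' with
    | add p q hp hq => simp [hp, hq]
    | monomial n a =>
      have : ∀ k : ℕ, (((A.restrict hA ^ k) w : W) : V) = (A ^ k) w := by
        intro k
        induction k with
        | zero => rfl
        | succ k ih => simp [pow_succ', ih]
      simp [Polynomial.aeval_monomial, this]
  have h2 := h (A.restrict hA).charpoly ⟨v, hv⟩
  rw [LinearMap.aeval_self_charpoly] at h2
  simpa using h2.symm

theorem trace_eq_neg_charpoly_coeff' [FiniteDimensional ℝ V] [Nontrivial V]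
    (A : Module.End ℝ V) :
    LinearMap.trace ℝ V A = -A.charpoly.coeff (Module.finrank ℝ V - 1) := by
  let b := Module.finBasis ℝ V
  have : Nonempty (Fin (Module.finrank ℝ V)) := ⟨⟨0, Module.finrank_pos⟩⟩
  rw [← LinearMap.charpoly_toMatrix A b, LinearMap.trace_eq_matrix_trace ℝ b,
    Matrix.trace_eq_neg_charpoly_coeff, Fintype.card_fin]

end Cyclic

/-! ### The Jordan trace: value at the unit, uniqueness and invariance -/

section JordanTrace

variable {J : Type*} [NonAssocCommRing J] [Module ℝ J] [IsScalarTower ℝ J J]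
  [SMulCommClass ℝ J J] [FiniteDimensional ℝ J]

theorem minDegree_eq_finrank_cyclicSpan (x : J) :
    minDegree x = Module.finrank ℝ (cyclicSpan (mulOp x) 1) := rfl

theorem bddAbove_range_minDegree : BddAbove (Set.range (minDegree : J → ℕ)) := by
  refine ⟨Module.finrank ℝ J, ?_⟩
  rintro _ ⟨x, rfl⟩
  exact Submodule.finrank_le _

theorem minDegree_le_rank (x : J) : minDegree x ≤ rank J :=
  le_csSup bddAbove_range_minDegree ⟨x, rfl⟩

variable (J) in
theorem exists_isRegularElt : ∃ x : J, IsRegularElt x :=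
  Nat.sSup_mem (Set.range_nonempty _) bddAbove_range_minDegree

variable (J) in
theorem rank_pos [Nontrivial J] : 0 < rank J := by
  refine lt_of_lt_of_le ?_ (minDegree_le_rank (1 : J))
  rw [minDegree_eq_finrank_cyclicSpan, Module.finrank_pos_iff_exists_ne_zero]
  exact ⟨⟨1, mem_cyclicSpan_self _ _⟩, fun h => one_ne_zero (congrArg Subtype.val h)⟩

theorem IsRegularElt.exists_monic {x : J} (hx : IsRegularElt x) : ∃ p : Polynomial ℝ,
    p.Monic ∧ p.natDegree = rank J ∧ (Polynomial.aeval (mulOp x) p) (1 : J) = 0 := by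
  let A := (mulOp x).restrict fun w hw => apply_mem_cyclicSpan (mulOp x) (1 : J) hw
  refine ⟨A.charpoly, A.charpoly_monic, ?_, ?_⟩
  · rw [LinearMap.charpoly_natDegree, ← hx, minDegree_eq_finrank_cyclicSpan]
  · exact aeval_charpoly_restrict _ _ (mem_cyclicSpan_self _ _)

/-- The characteristic polynomial of `L_x` on the powers of `x` is an admissible `p`. The subspace
enters through an equation so that `x` and `x + 1` can be treated on one and the same `W`. -/
theorem IsJordanTrace.eq_trace_restrict [Nontrivial J] {t : J →ₗ[ℝ] ℝ} (ht : IsJordanTrace J t)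
    {x : J} (hx : IsRegularElt x) {W : Submodule ℝ J} (hW : W = cyclicSpan (mulOp x) 1)
    (hA : ∀ w ∈ W, mulOp x w ∈ W) : t x = LinearMap.trace ℝ W ((mulOp x).restrict hA) := by
  have hdim : Module.finrank ℝ W = rank J := by
    rw [hW, ← hx, minDegree_eq_finrank_cyclicSpan]
  have : Nontrivial W := Module.nontrivial_of_finrank_pos (R := ℝ) (hdim ▸ rank_pos J)
  rw [trace_eq_neg_charpoly_coeff', hdim]
  refine ht x hx _ (LinearMap.charpoly_monic _) ?_ (aeval_charpoly_restrict _ _ ?_)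
  · rw [LinearMap.charpoly_natDegree, hdim]
  · rw [hW]
    exact mem_cyclicSpan_self _ _

/-- For regular `x`, passing to `x + 1` adds the identity to `L_x` on the same `r`-dimensional
cyclic span, so the trace grows by `r`. -/
theorem IsJordanTrace.map_one [Nontrivial J] {t : J →ₗ[ℝ] ℝ} (ht : IsJordanTrace J t) :
    t 1 = rank J := by
  obtain ⟨x, hx⟩ := exists_isRegularElt J
  have hop : mulOp (x + 1) = mulOp x + (1 : ℝ) • 1 := by
    ext z
    simp [mulOp, add_mul]
  have hspan : cyclicSpan (mulOp x) 1 = cyclicSpan (mulOp (x + 1)) (1 : J) := by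
    rw [hop, cyclicSpan_add_smul_one]
  have hx' : IsRegularElt (x + 1) := by
    rw [IsRegularElt, minDegree_eq_finrank_cyclicSpan, ← hspan]
    exact hx
  have hA : ∀ w ∈ cyclicSpan (mulOp x) (1 : J), mulOp x w ∈ cyclicSpan (mulOp x) (1 : J) :=
    fun w hw => apply_mem_cyclicSpan _ _ hw
  have hA' : ∀ w ∈ cyclicSpan (mulOp x) (1 : J), mulOp (x + 1) w ∈ cyclicSpan (mulOp x) (1 : J) :=
    fun w hw => by
      rw [hspan] at hw ⊢
      exact apply_mem_cyclicSpan _ _ hw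
  have h1 := ht.eq_trace_restrict hx rfl hA
  have h2 := ht.eq_trace_restrict hx' hspan hA'
  have h3 : (mulOp (x + 1)).restrict hA' = (mulOp x).restrict hA + 1 := by
    ext w
    simp [hop]
  rw [h3, map_add, map_add, ← h1, LinearMap.trace_one, add_right_inj,
    ← minDegree_eq_finrank_cyclicSpan, hx] at h2
  exact h2

variable (J) in
/-- A norm on `J`, pulled back along linear coordinates. -/
@[reducible] noncomputable def coordinateNorm : NormedAddCommGroup J :=
  NormedAddCommGroup.induced J (Fin (Module.finrank ℝ J) → ℝ)
    (Module.finBasis ℝ J).equivFun (Module.finBasis ℝ J).equivFun.injective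

variable (J) in
/-- `J` is a normed space for the norm of linear coordinates. -/
@[reducible] noncomputable def coordinateNormedSpace :
    @NormedSpace ℝ J _ (coordinateNorm J).toSeminormedAddCommGroup :=
  let _ := coordinateNorm J
  NormedSpace.induced ℝ J (Fin (Module.finrank ℝ J) → ℝ) (Module.finBasis ℝ J).equivFun

/-- Linear independence is an open condition, so the regular elements form a neighbourhood of any
regular element; a subspace with nonempty interior is the whole space. -/
theorem linearForm_ext_of_isRegularElt {s t : J →ₗ[ℝ] ℝ}
    (h : ∀ x : J, IsRegularElt x → s x = t x) : s = t := by
  let _ := coordinateNorm J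
  let _ := coordinateNormedSpace J
  have hcont : ∀ k : ℕ, Continuous fun x : J => ((mulOp x) ^ k) (1 : J) := by
    intro k
    induction k with
    | zero => exact continuous_const
    | succ k ih =>
      have : (fun x : J => ((mulOp x) ^ (k + 1)) (1 : J))
          = fun x => (LinearMap.mul ℝ J).toContinuousBilinearMap x (((mulOp x) ^ k) 1) := by
        ext x
        simp [pow_succ', mulOp]
      rw [this]
      fun_prop
  obtain ⟨x, hx⟩ := exists_isRegularElt J
  -- Powers of `x` that form a basis of their span. The same exponents stay independent for `y` near
  -- `x`, and the rank bounds the degree from above.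
  obtain ⟨κ, a, ha, hspan, hli⟩ :=
    exists_linearIndependent' ℝ fun k : ℕ => ((mulOp x) ^ k) (1 : J)
  have : Finite κ := hli.finite
  have : Fintype κ := Fintype.ofFinite κ
  have hcard : Fintype.card κ = rank J := by
    rw [← finrank_span_eq_card hli, hspan, ← hx]
    rfl
  have hev : ∀ᶠ y in nhds x, IsRegularElt y := by
    have h1 : Continuous fun y : J => fun i : κ => ((mulOp y) ^ a i) (1 : J) :=
      continuous_pi fun i => hcont (a i)
    filter_upwards [h1.continuousAt.eventually hli.eventually] with y hy
    refine le_antisymm (minDegree_le_rank y) ?_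
    rw [← hcard, ← finrank_span_eq_card hy]
    refine Submodule.finrank_mono (Submodule.span_mono ?_)
    rintro _ ⟨i, rfl⟩
    exact ⟨a i, rfl⟩
  have htop : LinearMap.ker (s - t) = ⊤ := by
    refine Submodule.eq_top_of_nonempty_interior' _ ⟨x, mem_interior_iff_mem_nhds.mpr ?_⟩
    filter_upwards [hev] with y hy
    simp [h y hy]
  exact sub_eq_zero.mp (LinearMap.ker_eq_top.mp htop)

/-- An automorphism carries powers to powers, so a regular `x` and `φ x` share their annihilating
polynomials. Regular elements suffice by `linearForm_ext_of_isRegularElt`. -/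
theorem IsJordanTrace.comp_automorphism {t : J →ₗ[ℝ] ℝ} (ht : IsJordanTrace J t)
    (φ : J ≃ₗ[ℝ] J) (hφ : ∀ x y, φ (x * y) = φ x * φ y) (x : J) : t (φ x) = t x := by
  have h1 : φ 1 = 1 := by
    have := hφ (φ.symm 1) 1
    rw [mul_one, φ.apply_symm_apply, one_mul] at this
    exact this.symm
  have hpow : ∀ (x : J) (k : ℕ), φ (((mulOp x) ^ k) 1) = ((mulOp (φ x)) ^ k) 1 := by
    intro x k
    induction k with
    | zero => simpa using h1
    | succ k ih => simp [pow_succ', mulOp, hφ] at ih ⊢; rw [ih]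
  have haeval : ∀ (x : J) (p : Polynomial ℝ), φ (Polynomial.aeval (mulOp x) p 1)
      = Polynomial.aeval (mulOp (φ x)) p 1 := by
    intro x p
    simp only [Polynomial.aeval_eq_sum_range, LinearMap.sum_apply, LinearMap.smul_apply, map_sum,
      map_smul, hpow]
  have hreg : ∀ x, IsRegularElt x → IsRegularElt (φ x) := by
    intro x hx
    rw [IsRegularElt, ← hx]
    have : cyclicSpan (mulOp (φ x)) (1 : J)
        = (cyclicSpan (mulOp x) (1 : J)).map φ.toLinearMap := by
      rw [cyclicSpan, cyclicSpan, Submodule.map_span, ← Set.range_comp]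
      congr 2
      ext k
      exact (hpow x k).symm
    rw [minDegree_eq_finrank_cyclicSpan, this, minDegree_eq_finrank_cyclicSpan]
    exact LinearEquiv.finrank_map_eq φ _
  refine LinearMap.congr_fun (linearForm_ext_of_isRegularElt (s := t ∘ₗ φ.toLinearMap)
    fun x hx => ?_) x
  obtain ⟨p, hp, hdeg, hroot⟩ := hx.exists_monic
  have e1 := ht x hx p hp hdeg hroot
  have e2 := ht (φ x) (hreg x hx) p hp hdeg (by rw [← haeval, hroot, map_zero])
  exact e2.trans e1.symm

theorem IsJordanTrace.apply_derivation {t : J →ₗ[ℝ] ℝ} (ht : IsJordanTrace J t)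
    (D : Module.End ℝ J) (hD : ∀ x y, D (x * y) = D x * y + x * D y) (z : J) : t (D z) = 0 :=
  let _ := coordinateNorm J
  let _ := coordinateNormedSpace J
  invariant_form_apply_derivation (LinearMap.mul ℝ J) D hD t
    (fun φ hφ x => ht.comp_automorphism φ hφ x) z

end JordanTrace

/-! ### Associativity of the trace form and of the regular form -/

section TraceForm

variable {J : Type*} [NonAssocCommRing J] [Module ℝ J] [IsScalarTower ℝ J J]
  [SMulCommClass ℝ J J] [FiniteDimensional ℝ J] {α : J →ₙₐ[ℝ] J}

theorem traceForm_apply (x y : J) : traceForm J x y = jordanTrace J (x * y) := rfl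

/-- If no Jordan trace existed, `jordanTrace` would take its default value `0`, against positivity
at the unit. -/
theorem IsCartanInvolution.isJordanTrace [Nontrivial J] (hα : IsCartanInvolution α) :
    IsJordanTrace J (jordanTrace J) := by
  have h : ∃ t : J →ₗ[ℝ] ℝ, IsJordanTrace J t := by
    by_contra hne
    have h1 := hα.posDef 1 one_ne_zero
    simp [traceForm_apply, jordanTrace, hne] at h1
  rw [jordanTrace, dif_pos h]
  exact h.choose_spec

/-- A Cartan involution as a linear equivalence. -/
def IsCartanInvolution.equiv (hα : IsCartanInvolution α) : J ≃ₗ[ℝ] J :=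
  LinearEquiv.ofInvolutive (α : J →ₗ[ℝ] J) hα.involutive

theorem IsCartanInvolution.jordanTrace_map [Nontrivial J] (hα : IsCartanInvolution α) (x : J) :
    jordanTrace J (α x) = jordanTrace J x :=
  hα.isJordanTrace.comp_automorphism hα.equiv (fun x y => map_mul α x y) x

theorem IsCartanInvolution.traceForm_map [Nontrivial J] (hα : IsCartanInvolution α) (x y : J) :
    traceForm J (α x) (α y) = traceForm J x y := by
  rw [traceForm_apply, ← map_mul, hα.jordanTrace_map, traceForm_apply]

theorem IsCartanInvolution.traceForm_map_left [Nontrivial J] (hα : IsCartanInvolution α)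
    (x y : J) : traceForm J (α x) y = traceForm J x (α y) := by
  rw [← hα.traceForm_map, hα.involutive]

variable [IsCommJordan J]

/-- The two sides differ by the Jordan trace of `[L_x, L_z] y`, and `[L_x, L_z]` is a derivation. -/
theorem IsCartanInvolution.traceForm_assoc [Nontrivial J] (hα : IsCartanInvolution α)
    (x y z : J) : traceForm J (x * y) z = traceForm J x (y * z) := by
  have h := hα.isJordanTrace.apply_derivation (mulOp x * mulOp z - mulOp z * mulOp x)
    (fun a c => by simpa [mulOp] using jordan_derivation x z a c) y
  simp only [LinearMap.sub_apply, Module.End.mul_apply, mulOp, LinearMap.mulLeft_apply, map_sub,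
    sub_eq_zero] at h
  rw [traceForm_apply, traceForm_apply, mul_comm y z, h, mul_comm]

/-- The bilinear form `(x, y) ↦ Tr L_{x y}`. -/
noncomputable def regularForm (J : Type*) [NonAssocCommRing J] [Module ℝ J] [IsScalarTower ℝ J J]
    [SMulCommClass ℝ J J] : LinearMap.BilinForm ℝ J :=
  (LinearMap.mul ℝ J).compr₂ (LinearMap.trace ℝ J ∘ₗ LinearMap.mul ℝ J)

theorem regularForm_apply (x y : J) :
    regularForm J x y = LinearMap.trace ℝ J (mulOp (x * y)) := rfl

/-- For the derivation `δ = [L_x, L_z]` one has `L_{δ y} = [δ, L_y]`, whose trace is zero. -/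
theorem regularForm_assoc (x y z : J) : regularForm J (x * y) z = regularForm J x (y * z) := by
  have h : mulOp (x * (z * y)) - mulOp (z * (x * y))
      = (mulOp x * mulOp z - mulOp z * mulOp x) * mulOp y
        - mulOp y * (mulOp x * mulOp z - mulOp z * mulOp x) := by
    ext c
    have := jordan_derivation x z y c
    simp only [mulOp, LinearMap.sub_apply, Module.End.mul_apply, LinearMap.mulLeft_apply,
      ← sub_mul]
    rw [this]
    abel
  have h2 := congrArg (LinearMap.trace ℝ J) h
  rw [map_sub, map_sub, LinearMap.trace_mul_comm ℝ _ (mulOp y), sub_self, sub_eq_zero] at h2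
  rw [regularForm_apply, regularForm_apply, mul_comm y z, h2, mul_comm]

end TraceForm

/-! ### Comparison of the regular trace with the Jordan trace -/

theorem exists_eigenvector_of_selfAdjoint {V : Type*} [AddCommGroup V] [Module ℝ V]
    [FiniteDimensional ℝ V] [Nontrivial V] (B : LinearMap.BilinForm ℝ V)
    (hsymm : ∀ x y, B x y = B y x) (hpos : ∀ x, x ≠ 0 → 0 < B x x) (S : Module.End ℝ V)
    (hS : ∀ x y, B (S x) y = B x (S y)) : ∃ (c : ℝ) (x : V), x ≠ 0 ∧ S x = c • x := by
  have hnonneg : ∀ x, 0 ≤ B x x := by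
    intro x
    by_cases h : x = 0
    · simp [h]
    · exact (hpos x h).le
  let core : InnerProductSpace.Core ℝ V :=
    { inner := fun x y => B x y
      conj_inner_symm := fun x y => hsymm y x
      re_inner_nonneg := hnonneg
      add_left := fun x y z => by simp
      smul_left := fun x y c => by simp
      definite := fun x hx => by
        by_contra hne
        exact (hpos x hne).ne' hx }
  let _ : NormedAddCommGroup V := core.toNormedAddCommGroup
  let _ : InnerProductSpace ℝ V := InnerProductSpace.ofCore core.toCore
  have hsym : S.IsSymmetric := hS
  obtain ⟨x, hx⟩ := hsym.hasEigenvalue_iSup_of_finiteDimensional.exists_hasEigenvector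
  exact ⟨_, x, hx.2, hx.apply_eq_smul⟩

section RegularTrace

variable {J : Type*} [NonAssocCommRing J] [Module ℝ J] [IsScalarTower ℝ J J]
  [SMulCommClass ℝ J J] [FiniteDimensional ℝ J] {α : J →ₙₐ[ℝ] J} [IsCommJordan J]

theorem IsCartanInvolution.regularForm_map (hα : IsCartanInvolution α) (x y : J) :
    regularForm J (α x) (α y) = regularForm J x y := by
  rw [regularForm_apply, regularForm_apply, ← map_mul,
    ← LinearMap.trace_conj' (mulOp (x * y)) hα.equiv]
  congr 1
  ext z
  have : hα.equiv.symm z = α z := rfl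
  simp only [LinearEquiv.conj_apply, LinearMap.comp_apply, LinearEquiv.coe_coe, mulOp,
    LinearMap.mulLeft_apply, this]
  change _ = α (x * y * α z)
  rw [map_mul, map_mul, hα.involutive, map_mul]

theorem regularForm_comm (x y : J) : regularForm J x y = regularForm J y x := by
  rw [regularForm_apply, regularForm_apply, mul_comm]

/-- On a simple algebra the regular trace is a multiple of the Jordan trace. -/
theorem IsCartanInvolution.trace_mulOp [IsSimpleRing J] (hα : IsCartanInvolution α) (x : J) :
    LinearMap.trace ℝ J (mulOp x) = (Module.finrank ℝ J : ℝ) / rank J * jordanTrace J x := by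
  have : Nontrivial J := inferInstance
  -- The ratio of the two forms: `τ(S x, z) = Tr L_{xz}`. Associativity of both makes it commute
  -- with multiplications.
  let S : Module.End ℝ J :=
    ((traceForm J).toDual hα.nondegenerate).symm.toLinearMap ∘ₗ regularForm J
  have hS : ∀ x z, traceForm J (S x) z = regularForm J x z := fun x z =>
    LinearMap.BilinForm.apply_toDual_symm_apply
      (hB := hα.nondegenerate) _ _
  have hSmul : ∀ x z, S (x * z) = S x * z := by
    intro x z
    rw [← sub_eq_zero]
    refine hα.nondegenerate.1 _ fun w => ?_
    rw [map_sub, LinearMap.sub_apply, hS, hα.traceForm_assoc, hS, regularForm_assoc, sub_self]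
  let B : LinearMap.BilinForm ℝ J := (traceForm J).compl₂ (α : J →ₗ[ℝ] J)
  have hB : ∀ x y, B x y = traceForm J x (α y) := fun x y => rfl
  -- Both forms are `α`-invariant, so `S` is self-adjoint for the positive definite `(·|·)`; this
  -- gives a real eigenvalue.
  obtain ⟨c, x₀, hx₀, hc⟩ := exists_eigenvector_of_selfAdjoint B
    (fun x y => by rw [hB, hB, ← hα.traceForm_map_left, traceForm_comm])
    hα.posDef S (fun x y => by
      rw [hB, hB, hS, ← hα.traceForm_map_left, traceForm_comm, hS, regularForm_comm,
        ← hα.regularForm_map, hα.involutive])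
  let I : TwoSidedIdeal J := TwoSidedIdeal.mk' {x | S x = c • x} (by simp)
    (fun {x y} hx hy => by
      simp only [Set.mem_ofPred_eq] at hx hy ⊢
      rw [map_add, hx, hy, smul_add])
    (fun {x} hx => by
      simp only [Set.mem_ofPred_eq] at hx ⊢
      rw [map_neg, hx, smul_neg])
    (fun {x y} hy => by
      simp only [Set.mem_ofPred_eq] at hy ⊢
      rw [mul_comm, hSmul, hy, smul_mul_assoc])
    (fun {x y} hx => by
      simp only [Set.mem_ofPred_eq] at hx ⊢
      rw [hSmul, hx, smul_mul_assoc])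
  have hI : I = ⊤ := by
    refine (eq_bot_or_eq_top I).resolve_left fun h => hx₀ ?_
    have : x₀ ∈ I := (TwoSidedIdeal.mem_mk' _ _ _ _ _ _ _).mpr hc
    rwa [h, TwoSidedIdeal.mem_bot] at this
  have hSc : ∀ x, S x = c • x := by
    intro x
    have : x ∈ I := hI ▸ TwoSidedIdeal.mem_top J
    exact (TwoSidedIdeal.mem_mk' {x | S x = c • x} _ _ _ _ _ x).mp this
  have htr : ∀ x, LinearMap.trace ℝ J (mulOp x) = c * jordanTrace J x := by
    intro x
    have h := hS x 1
    rw [hSc, map_smul, LinearMap.smul_apply, smul_eq_mul, traceForm_apply, regularForm_apply,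
      mul_one] at h
    exact h.symm
  have hone : mulOp (1 : J) = 1 := by
    ext z
    simp [mulOp]
  -- At the unit the identity reads `n = c r`.
  have h1 := htr 1
  rw [hone, LinearMap.trace_one, hα.isJordanTrace.map_one] at h1
  have hr : (rank J : ℝ) ≠ 0 := by exact_mod_cast (rank_pos J).ne'
  rw [htr, h1, mul_div_cancel_right₀ _ hr]

/-- The value of the trace character on `D_{x,y}`. -/
theorem IsCartanInvolution.trace_opD [IsSimpleRing J] (hα : IsCartanInvolution α) (x y : J) :
    LinearMap.trace ℝ J (opD x y)
      = 2 * ((Module.finrank ℝ J : ℝ) / rank J) * traceForm J x y := by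
  rw [opD, map_smul, map_sub, map_add, LinearMap.trace_mul_comm ℝ (mulOp x), add_sub_cancel_left,
    hα.trace_mulOp, traceForm_apply, smul_eq_mul]
  ring

/-- `D_{y,x}` is the adjoint of `D_{x,y}` for the trace form. -/
theorem IsCartanInvolution.traceForm_sharpEnd [Nontrivial J] (hα : IsCartanInvolution α)
    {T : Module.End ℝ J} (hT : T ∈ str J) (u w : J) :
    traceForm J (sharpEnd J T u) w = traceForm J u (T w) := by
  have hcomm : ∀ a b c : J, traceForm J (a * b) c = traceForm J b (a * c) := by
    intro a b c
    rw [mul_comm a b, hα.traceForm_assoc]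
  refine Submodule.span_induction (p := fun T _ =>
    traceForm J (sharpEnd J T u) w = traceForm J u (T w)) ?_ ?_ ?_ ?_ hT
  · rintro _ ⟨x, y, rfl⟩
    rw [sharpEnd_opD]
    simp only [opD_apply, map_smul, map_add, map_sub, LinearMap.add_apply, LinearMap.sub_apply,
      LinearMap.smul_apply, hcomm, mul_comm y x]
  · simp
  · intro A C _ _ hA hC
    simp [hA, hC]
  · intro c A _ hA
    simp [hA]

/-- The quadratic operators `P_{a,c}` are dual to the triple product. -/
theorem IsCartanInvolution.traceForm_opD_eq_opP [Nontrivial J] (hα : IsCartanInvolution α)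
    (v a c x : J) :
    traceForm J (opD a v c) x = 2 * traceForm J v (opP a c x) := by
  have hcomm : ∀ a b c : J, traceForm J (a * b) c = traceForm J b (a * c) := by
    intro a b c
    rw [mul_comm a b, hα.traceForm_assoc]
  have h1 : traceForm J ((a * v) * c) x = traceForm J v (a * (c * x)) := by
    rw [hα.traceForm_assoc, hcomm]
  have h2 : traceForm J (v * (a * c)) x = traceForm J v ((a * c) * x) := hα.traceForm_assoc _ _ _
  have h3 : traceForm J (a * (v * c)) x = traceForm J v (c * (a * x)) := by
    rw [hcomm, hα.traceForm_assoc]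
  rw [opD_apply, opP_apply, map_smul, map_sub, map_add, LinearMap.smul_apply,
    LinearMap.sub_apply, LinearMap.add_apply, h1, h2, h3, map_sub, map_add, smul_eq_mul]
  ring

end RegularTrace

/-! ### Representations of `co(J)` on differential models -/

section Model

/-- A commutative algebra `A` with multiplication operators `μ v` and directional derivatives
`d w`, on which an operator commuting with all `μ v` is determined by its value at `1`. -/
structure DifferentialModel {V : Type*} [AddCommGroup V] [Module ℝ V]
    (B : LinearMap.BilinForm ℝ V) (A : Type*) [CommRing A] [Algebra ℝ A] where
  μ : V →ₗ[ℝ] A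
  d : V →ₗ[ℝ] Module.End ℝ A
  d_one : ∀ w, d w 1 = 0
  d_mul : ∀ w v a, d w (μ v * a) = B v w • a + μ v * d w a
  rigid : ∀ O : Module.End ℝ A, (∀ v a, O (μ v * a) = μ v * O a) → O 1 = 0 → O = 0

/-- The families `e` and `f` are dual to each other for the form `B`. -/
def IsDualPair {V : Type*} [AddCommGroup V] [Module ℝ V] (B : LinearMap.BilinForm ℝ V) {m : ℕ}
    (e f : Fin m → V) : Prop := ∀ v, ∑ i, B v (f i) • e i = v

variable {J : Type*} [NonAssocCommRing J] [Module ℝ J] [IsScalarTower ℝ J J]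
  [SMulCommClass ℝ J J]

theorem opD_add_left (x x' y : J) : opD (x + x') y = opD x y + opD x' y := by
  ext z
  simp only [opD_apply, add_mul, mul_add, LinearMap.add_apply]
  module

theorem opD_add_right (x y y' : J) : opD x (y + y') = opD x y + opD x y' := by
  ext z
  simp only [opD_apply, add_mul, mul_add, LinearMap.add_apply]
  module

theorem opD_smul_left (c : ℝ) (x y : J) : opD (c • x) y = c • opD x y := by
  ext z
  simp only [opD_apply, smul_mul_assoc, mul_smul_comm, LinearMap.smul_apply]
  module

theorem opD_smul_right (c : ℝ) (x y : J) : opD x (c • y) = c • opD x y := by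
  ext z
  simp only [opD_apply, smul_mul_assoc, mul_smul_comm, LinearMap.smul_apply]
  module

/-- `(x, y) ↦ D_{x,y}` as a bilinear map to the structure algebra. -/
def strDHom : J →ₗ[ℝ] J →ₗ[ℝ] str J :=
  LinearMap.mk₂ ℝ strD (fun x x' y => Subtype.ext (opD_add_left x x' y))
    (fun c x y => Subtype.ext (opD_smul_left c x y))
    (fun x y y' => Subtype.ext (opD_add_right x y y'))
    (fun c x y => Subtype.ext (opD_smul_right c x y))

@[simp] theorem strDHom_apply (x y : J) : strDHom x y = strD x y := rfl

variable {A : Type*} [CommRing A] [Algebra ℝ A] {B : LinearMap.BilinForm ℝ J}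
  (N : DifferentialModel B A) (χ : str J →ₗ[ℝ] ℝ) {m : ℕ} (e f : Fin m → J)

namespace DifferentialModel

/-- The operator of `T` in the structure algebra: a first order differential operator. -/
noncomputable def opZero : str J →ₗ[ℝ] Module.End ℝ A where
  toFun T := χ T • 1 - ∑ i, LinearMap.mulLeft ℝ (N.μ (sharpEnd J T (e i))) * N.d (f i)
  map_add' S T := by
    ext a
    simp [add_mul, Finset.sum_add_distrib, add_smul]
    abel
  map_smul' c T := by
    ext a
    simp [Finset.smul_sum, smul_sub, smul_smul]

theorem opZero_apply (T : str J) (a : A) : N.opZero χ e f T a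
    = χ T • a - ∑ i, N.μ (sharpEnd J T (e i)) * N.d (f i) a := by
  simp [opZero]

/-- The operator of `x ∈ V₊`: a second order differential operator. -/
noncomputable def opPlus : J →ₗ[ℝ] Module.End ℝ A where
  toFun x := ∑ i, χ (strD x (e i)) • N.d (f i)
    - (1 / 2 : ℝ) • ∑ i, ∑ j,
      LinearMap.mulLeft ℝ (N.μ (opD (e i) x (e j))) * (N.d (f j) * N.d (f i))
  map_add' x y := by
    ext a
    simp only [← strDHom_apply, map_add, LinearMap.add_apply, opD_add_right, add_smul,
      Finset.sum_add_distrib, LinearMap.sub_apply, LinearMap.smul_apply, LinearMap.sum_apply,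
      Module.End.mul_apply, LinearMap.mulLeft_apply, add_mul, smul_add]
    abel
  map_smul' c x := by
    ext a
    simp only [← strDHom_apply, map_smul, LinearMap.smul_apply, opD_smul_right, smul_mul_assoc,
      LinearMap.sub_apply, LinearMap.sum_apply, Module.End.mul_apply, LinearMap.mulLeft_apply,
      smul_sub, Finset.smul_sum, smul_smul, smul_eq_mul, RingHom.id_apply]
    simp only [mul_comm c]

theorem opPlus_apply (x : J) (a : A) : N.opPlus χ e f x a
    = ∑ i, χ (strD x (e i)) • N.d (f i) a
      - (1 / 2 : ℝ) • ∑ i, ∑ j, N.μ (opD (e i) x (e j)) * N.d (f j) (N.d (f i) a) := by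
  simp [opPlus]

theorem opZero_one (T : str J) : N.opZero χ e f T 1 = χ T • 1 := by
  simp [opZero_apply, N.d_one]

theorem opPlus_one (x : J) : N.opPlus χ e f x 1 = 0 := by
  simp [opPlus_apply, N.d_one]

variable {e f} (hef : IsDualPair B e f)
include hef

/-- The sum over the dual pair collapses by the reproducing identity. This is the bracket `[T, v] =
-T♯ v` of `co(J)`. -/
theorem opZero_mul (T : str J) (v : J) (a : A) : N.opZero χ e f T (N.μ v * a)
    = N.μ v * N.opZero χ e f T a - N.μ (sharpEnd J T v) * a := by
  have h : N.μ (sharpEnd J T v) * a = ∑ i, B v (f i) • (N.μ (sharpEnd J T (e i)) * a) := by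
    conv_lhs => rw [← hef v]
    simp [Finset.sum_mul]
  rw [opZero_apply, opZero_apply, h, mul_sub, sub_sub, Finset.mul_sum, ← Finset.sum_add_distrib,
    mul_smul_comm]
  congr 1
  refine Finset.sum_congr rfl fun i _ => ?_
  rw [N.d_mul, mul_add, mul_smul_comm]
  ring

/-- Moving `μ v` past two derivatives leaves two single sums, equal because `D_{a,x} c = D_{c,x} a`;
the factor `1/2` turns them into the first order part of `D_{x,v}`. The operators `d w` need not
commute for this. -/
theorem opPlus_mul (x v : J) (a : A) : N.opPlus χ e f x (N.μ v * a)
    = N.μ v * N.opPlus χ e f x a + N.opZero χ e f (strD x v) a := by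
  have h1 : χ (strD x v) = ∑ i, B v (f i) * χ (strD x (e i)) := by
    conv_lhs => rw [← hef v]
    simp [← strDHom_apply]
  have h2 : ∀ z, N.μ (opD v x z) = ∑ i, B v (f i) • N.μ (opD (e i) x z) := by
    intro z
    conv_lhs => rw [← hef v]
    rw [opD_symm, map_sum, map_sum]
    simp [opD_symm z, opD_smul_left]
  have h3 : ∀ j, N.μ (opD v x (e j)) * N.d (f j) a
      = ∑ i, B v (f i) • (N.μ (opD (e i) x (e j)) * N.d (f j) a) := by
    intro j
    simp [h2, Finset.sum_mul]
  have h4 : ∑ i, ∑ j, N.μ (opD (e i) x (e j)) * N.d (f j) (N.d (f i) (N.μ v * a))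
      = (2 : ℝ) • ∑ j, N.μ (opD v x (e j)) * N.d (f j) a
        + N.μ v * ∑ i, ∑ j, N.μ (opD (e i) x (e j)) * N.d (f j) (N.d (f i) a) := by
    have h5 : ∀ i j, N.μ (opD (e i) x (e j)) * N.d (f j) (N.d (f i) (N.μ v * a))
        = B v (f i) • (N.μ (opD (e i) x (e j)) * N.d (f j) a)
          + B v (f j) • (N.μ (opD (e j) x (e i)) * N.d (f i) a)
          + N.μ v * (N.μ (opD (e i) x (e j)) * N.d (f j) (N.d (f i) a)) := by
      intro i j
      rw [N.d_mul, map_add, map_smul, N.d_mul, opD_symm (e j)]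
      simp only [mul_add, mul_smul_comm]
      ring
    simp only [h5, Finset.sum_add_distrib, h3, Finset.mul_sum]
    congr 1
    rw [Finset.sum_comm, two_smul]
  have h6 : ∑ i, χ (strD x (e i)) • N.d (f i) (N.μ v * a)
      = (∑ i, B v (f i) * χ (strD x (e i))) • a
        + N.μ v * ∑ i, χ (strD x (e i)) • N.d (f i) a := by
    rw [Finset.sum_smul, Finset.mul_sum, ← Finset.sum_add_distrib]
    refine Finset.sum_congr rfl fun i _ => ?_
    rw [N.d_mul, smul_add, smul_smul, mul_comm (χ _), mul_smul_comm]
  have h7 : sharpEnd J (strD x v) = opD v x := sharpEnd_opD x v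
  rw [opPlus_apply, opPlus_apply, opZero_apply, h4, h1, h6, h7, smul_add, smul_smul, mul_sub,
    mul_smul_comm (1 / 2 : ℝ)]
  norm_num
  abel

variable [IsCommJordan J]

theorem opZero_comm (hχ : ∀ S T, χ (strComm S T) = 0) (S T : str J) :
    N.opZero χ e f S * N.opZero χ e f T - N.opZero χ e f T * N.opZero χ e f S
      = N.opZero χ e f (strComm S T) := by
  rw [← sub_eq_zero]
  refine N.rigid _ (fun v a => ?_) ?_
  · have h : sharpEnd J (strComm S T) v = sharpEnd J T (sharpEnd J S v)
        - sharpEnd J S (sharpEnd J T v) :=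
      LinearMap.congr_fun (sharpEnd_commutator S.2 T.2) v
    simp only [LinearMap.sub_apply, Module.End.mul_apply, opZero_mul N χ hef, map_sub, h]
    ring
  · simp [opZero_one, hχ, smul_smul, mul_comm (χ S)]

/-- Commuting with `μ v` reduces it to `opZero_comm` for `T` and `D_{x,v}`; at `1` all terms vanish
since `P_x 1 = 0` and `O_T 1` is a scalar. -/
theorem opZero_opPlus (hχ : ∀ S T, χ (strComm S T) = 0) (T : str J) (x : J) :
    N.opZero χ e f T * N.opPlus χ e f x - N.opPlus χ e f x * N.opZero χ e f T
      = N.opPlus χ e f ((T : Module.End ℝ J) x) := by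
  rw [← sub_eq_zero]
  refine N.rigid _ (fun v a => ?_) ?_
  · have h1 : strComm T (strD x v)
        = strD ((T : Module.End ℝ J) x) v - strD x (sharpEnd J T v) :=
      Subtype.ext (str_commutator T.2 x v)
    have h2 := LinearMap.congr_fun (N.opZero_comm χ hef hχ T (strD x v)) a
    rw [h1, map_sub] at h2
    simp only [LinearMap.sub_apply, Module.End.mul_apply, opZero_mul N χ hef,
      opPlus_mul N χ hef, map_sub, map_add] at h2 ⊢
    linear_combination h2
  · simp [opZero_one, opPlus_one]

/-- The commutator with `μ v` is `P_{D_{x,v} y} - P_{D_{y,v} x}`, which is zero by symmetry of the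
triple product. -/
theorem opPlus_comm (hχ : ∀ S T, χ (strComm S T) = 0) (x y : J) :
    N.opPlus χ e f x * N.opPlus χ e f y - N.opPlus χ e f y * N.opPlus χ e f x = 0 := by
  refine N.rigid _ (fun v a => ?_) ?_
  · have h1 := LinearMap.congr_fun (N.opZero_opPlus χ hef hχ (strD x v) y) a
    have h2 := LinearMap.congr_fun (N.opZero_opPlus χ hef hχ (strD y v) x) a
    have h3 : (strD x v : Module.End ℝ J) y = (strD y v : Module.End ℝ J) x := opD_symm x v y
    rw [h3] at h1
    simp only [LinearMap.sub_apply, Module.End.mul_apply, opPlus_mul N χ hef, map_add] at h1 h2 ⊢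
    linear_combination h1 - h2
  · simp [opPlus_one]

theorem opZero_mulLeft (T : str J) (v : J) :
    LinearMap.mulLeft ℝ (N.μ (sharpEnd J T v)) = LinearMap.mulLeft ℝ (N.μ v) * N.opZero χ e f T
      - N.opZero χ e f T * LinearMap.mulLeft ℝ (N.μ v) := by
  ext a
  simp [opZero_mul N χ hef]

theorem opPlus_mulLeft (x v : J) :
    N.opPlus χ e f x * LinearMap.mulLeft ℝ (N.μ v) - LinearMap.mulLeft ℝ (N.μ v)
      * N.opPlus χ e f x = N.opZero χ e f (strD x v) := by
  ext a
  simp [opPlus_mul N χ hef]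

/-- The representation of `co(J)` by differential operators. -/
noncomputable def rep (hχ : ∀ S T, χ (strComm S T) = 0) : Co J →ₗ⁅ℝ⁆ Module.End ℝ A where
  toFun X := N.opPlus χ e f X.plus + N.opZero χ e f X.zero + LinearMap.mulLeft ℝ (N.μ X.minus)
  map_add' X Y := by
    ext a
    simp [add_mul]
    abel
  map_smul' c X := by
    ext a
    simp
  map_lie' {X Y} := by
    have hz : ⁅X, Y⁆.zero = strComm X.zero Y.zero + strD X.plus Y.minus - strD Y.plus X.minus := rfl
    have hm : LinearMap.mulLeft ℝ (N.μ X.minus) * LinearMap.mulLeft ℝ (N.μ Y.minus)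
        = LinearMap.mulLeft ℝ (N.μ Y.minus) * LinearMap.mulLeft ℝ (N.μ X.minus) := by
      ext a
      simp [mul_left_comm]
    have e1 := N.opPlus_comm χ hef hχ X.plus Y.plus
    have e2 := N.opZero_comm χ hef hχ X.zero Y.zero
    have e3 := N.opZero_opPlus χ hef hχ X.zero Y.plus
    have e4 := N.opZero_opPlus χ hef hχ Y.zero X.plus
    have e5 := N.opZero_mulLeft χ hef X.zero Y.minus
    have e6 := N.opZero_mulLeft χ hef Y.zero X.minus
    have e7 := N.opPlus_mulLeft χ hef X.plus Y.minus
    have e8 := N.opPlus_mulLeft χ hef Y.plus X.minus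
    have hsub : ∀ a b : A, LinearMap.mulLeft ℝ (a - b)
        = LinearMap.mulLeft ℝ a - LinearMap.mulLeft ℝ b := fun a b => by
      ext c
      simp [sub_mul]
    simp only [Co.lie_plus, Co.lie_minus, hz, map_sub, map_add, hsub, Ring.lie_def]
    rw [← e3, ← e4, ← e2, ← e7, ← e8, e5, e6]
    linear_combination (norm := noncomm_ring) -e1 - hm

theorem rep_apply (hχ : ∀ S T, χ (strComm S T) = 0) (X : Co J) (a : A) :
    N.rep χ hef hχ X a
      = N.opPlus χ e f X.plus a + N.opZero χ e f X.zero a + N.μ X.minus * a := rfl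

/-- Neither the commutators with `μ v` nor the value at `1` mentions the dual pair, so rigidity
gives independence of the basis. -/
theorem opZero_eq {m' : ℕ} {e' f' : Fin m' → J} (hef' : IsDualPair B e' f') :
    N.opZero χ e f = N.opZero χ e' f' := by
  ext1 T
  rw [← sub_eq_zero]
  refine N.rigid _ (fun v a => ?_) ?_
  · simp only [LinearMap.sub_apply, opZero_mul N χ hef, opZero_mul N χ hef']
    ring
  · simp [opZero_one]

theorem opPlus_eq {m' : ℕ} {e' f' : Fin m' → J} (hef' : IsDualPair B e' f') :
    N.opPlus χ e f = N.opPlus χ e' f' := by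
  ext1 x
  rw [← sub_eq_zero]
  refine N.rigid _ (fun v a => ?_) ?_
  · simp only [LinearMap.sub_apply, opPlus_mul N χ hef, opPlus_mul N χ hef',
      N.opZero_eq χ hef hef']
    ring
  · simp [opPlus_one]

/-- The locus where `F` intertwines contains `1` and is stable under each `μ v`; `hgen` says that
this is everything. -/
theorem map_rep {A' : Type*} [CommRing A'] [Algebra ℝ A'] (N' : DifferentialModel B A')
    (F : A →ₐ[ℝ] A') (hF : ∀ v, F (N.μ v) = N'.μ v)
    (hgen : ∀ W : Submodule ℝ A, 1 ∈ W → (∀ v, ∀ a ∈ W, N.μ v * a ∈ W) → W = ⊤)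
    (hχ : ∀ S T, χ (strComm S T) = 0) (X : Co J) (a : A) :
    F (N.rep χ hef hχ X a) = N'.rep χ hef hχ X (F a) := by
  have hz : ∀ T a, F (N.opZero χ e f T a) = N'.opZero χ e f T (F a) := by
    intro T
    have h := hgen (LinearMap.eqLocus (F.toLinearMap ∘ₗ N.opZero χ e f T)
      (N'.opZero χ e f T ∘ₗ F.toLinearMap)) (by simp [opZero_one]) (fun v a ha => by
        simp only [LinearMap.mem_eqLocus, LinearMap.comp_apply, AlgHom.toLinearMap_apply] at ha ⊢
        rw [opZero_mul N χ hef, map_sub, map_mul, map_mul, map_mul, ha, hF, hF,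
          opZero_mul N' χ hef])
    intro a
    exact (h ▸ Submodule.mem_top : a ∈ LinearMap.eqLocus (F.toLinearMap ∘ₗ N.opZero χ e f T)
      (N'.opZero χ e f T ∘ₗ F.toLinearMap))
  have hp : ∀ x a, F (N.opPlus χ e f x a) = N'.opPlus χ e f x (F a) := by
    intro x
    have h := hgen (LinearMap.eqLocus (F.toLinearMap ∘ₗ N.opPlus χ e f x)
      (N'.opPlus χ e f x ∘ₗ F.toLinearMap)) (by simp [opPlus_one]) (fun v a ha => by
        simp only [LinearMap.mem_eqLocus, LinearMap.comp_apply, AlgHom.toLinearMap_apply] at ha ⊢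
        rw [opPlus_mul N χ hef, map_add, map_mul, map_mul, ha, hF, hz,
          opPlus_mul N' χ hef])
    intro a
    exact (h ▸ Submodule.mem_top : a ∈ LinearMap.eqLocus (F.toLinearMap ∘ₗ N.opPlus χ e f x)
      (N'.opPlus χ e f x ∘ₗ F.toLinearMap))
  rw [rep_apply, rep_apply, map_add, map_add, map_mul, hz, hp, hF]

end DifferentialModel

end Model

/-! ### Dual bases for the trace form -/

section DualPairs

theorem isDualPair_of_basis {V : Type*} [AddCommGroup V] [Module ℝ V]
    {B : LinearMap.BilinForm ℝ V} {m : ℕ} (b : Module.Basis (Fin m) ℝ V) (f : Fin m → V)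
    (h : ∀ i j, B (b i) (f j) = if i = j then 1 else 0) : IsDualPair B b f := by
  intro v
  conv_rhs => rw [← b.sum_repr v]
  refine Finset.sum_congr rfl fun i _ => ?_
  congr 1
  conv_lhs => rw [← b.sum_repr v]
  simp [h, -Module.Basis.sum_repr]

variable {J : Type*} [NonAssocCommRing J] [Module ℝ J] [IsScalarTower ℝ J J]
  [SMulCommClass ℝ J J] [FiniteDimensional ℝ J] {α : J →ₙₐ[ℝ] J} (hα : IsCartanInvolution α)
include hα

theorem IsCartanInvolution.traceForm_dual {m : ℕ} (e : Module.Basis (Fin m) ℝ J) (i j : Fin m) :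
    traceForm J (e i) (hα.dual e j) = if i = j then 1 else 0 := by
  rw [traceForm_comm]
  exact LinearMap.BilinForm.apply_dualBasis_left _ _ _ _

theorem IsCartanInvolution.isDualPair {m : ℕ} (e : Module.Basis (Fin m) ℝ J) :
    IsDualPair (traceForm J) e (hα.dual e) :=
  isDualPair_of_basis e _ (hα.traceForm_dual e)

theorem IsCartanInvolution.isDualPair_symm {m : ℕ} (e : Module.Basis (Fin m) ℝ J) :
    IsDualPair (traceForm J) (hα.dual e) e :=
  isDualPair_of_basis _ _ fun i j => by
    rw [traceForm_comm, hα.traceForm_dual]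
    simp [eq_comm]

end DualPairs

/-! ### The symmetric algebra as a model -/

section SymmetricModel

theorem symPartial_ι_mul {V : Type*} [AddCommGroup V] [Module ℝ V] {m : ℕ}
    (b : Module.Basis (Fin m) ℝ V) (i : Fin m) (v : V) (p : SymmetricAlgebra ℝ V) :
    symPartial b i (SymmetricAlgebra.ι ℝ V v * p)
      = b.repr v i • p + SymmetricAlgebra.ι ℝ V v * symPartial b i p := by
  have h : MvPolynomial.pderiv i (SymmetricAlgebra.equivMvPolynomial b (SymmetricAlgebra.ι ℝ V v))
      = MvPolynomial.C (b.repr v i) := by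
    conv_lhs => rw [← b.sum_repr v]
    simp [MvPolynomial.pderiv_X, Pi.single_apply, MvPolynomial.smul_eq_C_mul,
      -Module.Basis.sum_repr]
  simp only [symPartial, LinearMap.comp_apply, AlgEquiv.toLinearMap_apply, map_mul]
  erw [Derivation.leibniz]
  rw [h]
  simp only [smul_eq_mul, map_add, map_mul, AlgEquiv.symm_apply_apply]
  rw [add_comm, mul_comm, ← MvPolynomial.algebraMap_eq, AlgEquiv.commutes, Algebra.smul_def]
  rfl

theorem symPartial_one {V : Type*} [AddCommGroup V] [Module ℝ V] {m : ℕ}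
    (b : Module.Basis (Fin m) ℝ V) (i : Fin m) : symPartial b i 1 = 0 := by
  simp [symPartial]

theorem submodule_symmetricAlgebra_eq_top {V : Type*} [AddCommGroup V] [Module ℝ V]
    (W : Submodule ℝ (SymmetricAlgebra ℝ V)) (h1 : 1 ∈ W)
    (hmul : ∀ v, ∀ a ∈ W, SymmetricAlgebra.ι ℝ V v * a ∈ W) : W = ⊤ := by
  have key : ∀ a : SymmetricAlgebra ℝ V, ∀ p ∈ W, a * p ∈ W := by
    intro a
    induction a using SymmetricAlgebra.induction with
    | algebraMap r =>
      intro p hp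
      rw [← Algebra.smul_def]
      exact W.smul_mem r hp
    | ι x => exact hmul x
    | mul a b ha hb =>
      intro p hp
      rw [mul_assoc]
      exact ha _ (hb _ hp)
    | add a b ha hb =>
      intro p hp
      rw [add_mul]
      exact add_mem (ha _ hp) (hb _ hp)
  exact eq_top_iff.mpr fun a _ => by simpa using key a 1 h1

variable (J : Type*) [NonAssocCommRing J] [Module ℝ J] [IsScalarTower ℝ J J]
  [SMulCommClass ℝ J J] [IsCommJordan J]

/-- The identification of `J` with `V₋`. -/
def minusEquiv : J ≃ₗ[ℝ] (coGrading J).minus where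
  toFun v := ⟨Co.mk 0 0 v, rfl, rfl⟩
  invFun X := (X : Co J).minus
  map_add' u v := Subtype.ext (Co.ext_iff' (by simp) (by simp) (by simp))
  map_smul' c v := Subtype.ext (Co.ext_iff' (by simp) (by simp) (by simp))
  left_inv v := rfl
  right_inv X := Subtype.ext (Co.ext_iff' X.2.1.symm (by simp [X.2.2]) rfl)

variable {J}

theorem minusEquiv_symm_apply (X : (coGrading J).minus) :
    (minusEquiv J).symm X = (X : Co J).minus := rfl

variable (J) [FiniteDimensional ℝ J]

/-- The symmetric algebra `S(V₋)` as a differential model. -/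
noncomputable def symmetricModel :
    DifferentialModel (traceForm J) (SymmetricAlgebra ℝ (coGrading J).minus) where
  μ := SymmetricAlgebra.ι ℝ _ ∘ₗ (minusEquiv J).toLinearMap
  -- The derivation that sends the generator `v` to `τ(v, w)`, written in an auxiliary basis.
  d := ∑ i, (traceForm J (Module.finBasis ℝ J i)).smulRight
    (symPartial ((Module.finBasis ℝ J).map (minusEquiv J)) i)
  d_one w := by simp [symPartial_one]
  d_mul w v a := by
    have h : traceForm J v w = ∑ i, traceForm J (Module.finBasis ℝ J i) w
        * (Module.finBasis ℝ J).repr v i := by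
      conv_lhs => rw [← (Module.finBasis ℝ J).sum_repr v]
      simp [mul_comm, -Module.Basis.sum_repr]
    simp [symPartial_ι_mul, h, Finset.sum_add_distrib, Finset.mul_sum, Finset.sum_smul, smul_smul]
  rigid O hO h1 := by
    refine LinearMap.ker_eq_top.mp (submodule_symmetricAlgebra_eq_top _ h1 fun v a ha => ?_)
    have := hO ((minusEquiv J).symm v) a
    rw [LinearMap.mem_ker] at ha ⊢
    simpa [ha] using this

variable {J}

theorem symmetricModel_μ (v : J) :
    (symmetricModel J).μ v = SymmetricAlgebra.ι ℝ _ (minusEquiv J v) := rfl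

/-- The abstract derivative along a `τ`-dual vector is the coordinate derivative: they agree on
generators and at `1`, so their difference is zero by rigidity. -/
theorem IsCartanInvolution.symmetricModel_d {α : J →ₙₐ[ℝ] J} (hα : IsCartanInvolution α) {m : ℕ}
    (b : Module.Basis (Fin m) ℝ (coGrading J).minus) (i : Fin m) :
    (symmetricModel J).d (hα.dual (b.map (minusEquiv J).symm) i) = symPartial b i := by
  rw [← sub_eq_zero]
  refine (symmetricModel J).rigid _ (fun v a => ?_) ?_
  · have h : traceForm J v (hα.dual (b.map (minusEquiv J).symm) i)
        = b.repr (minusEquiv J v) i := by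
      have hv := (b.map (minusEquiv J).symm).sum_repr v
      conv_lhs => rw [← hv]
      simp only [map_sum, LinearMap.sum_apply, map_smul, LinearMap.smul_apply, hα.traceForm_dual]
      simp
    rw [LinearMap.sub_apply, LinearMap.sub_apply, (symmetricModel J).d_mul, symmetricModel_μ,
      symPartial_ι_mul, h]
    ring
  · rw [LinearMap.sub_apply, (symmetricModel J).d_one, symPartial_one, sub_zero]

end SymmetricModel

/-! ### Smooth functions as a model -/

section SmoothModel

variable {J : Type*} [NonAssocCommRing J] [Module ℝ J] [IsScalarTower ℝ J J]
  [SMulCommClass ℝ J J] [FiniteDimensional ℝ J]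

theorem mem_smoothFun_of_coordinates {g : (Fin (Module.finrank ℝ J) → ℝ) → ℝ}
    (hg : ContDiff ℝ ∞ g) (c : (Fin (Module.finrank ℝ J) → ℝ) ≃ₗ[ℝ] J) :
    (fun x => g (c.symm x)) ∈ SmoothFun J ℝ := fun c' =>
  hg.comp (LinearMap.toContinuousLinearMap (c'.trans c.symm).toLinearMap).contDiff

theorem hasDerivAt_dirDeriv (f : SmoothFun J ℝ) (w x : J) :
    HasDerivAt (fun t : ℝ => f.1 (x + t • w)) (dirDeriv w f.1 x) 0 := by
  let c := (Module.finBasis ℝ J).equivFun.symm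
  have h1 : HasDerivAt (fun t : ℝ => c.symm x + t • c.symm w) (c.symm w) 0 := by
    simpa using ((hasDerivAt_id (0 : ℝ)).smul_const (c.symm w)).const_add (c.symm x)
  have h2 := ((f.2 c).differentiable (by simp) (c.symm x + (0 : ℝ) • c.symm w)).hasFDerivAt
  have h3 := (h2.comp_hasDerivAt (0 : ℝ) h1).differentiableAt
  have h4 : (fun t : ℝ => f.1 (x + t • w))
      = (fun y => f.1 (c y)) ∘ fun t : ℝ => c.symm x + t • c.symm w := by
    ext t
    simp
  rw [← h4] at h3
  exact h3.hasDerivAt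

theorem dirDeriv_eq_fderiv (f : SmoothFun J ℝ) (w : J)
    (c : (Fin (Module.finrank ℝ J) → ℝ) ≃ₗ[ℝ] J) (y : Fin (Module.finrank ℝ J) → ℝ) :
    dirDeriv w f.1 (c y) = fderiv ℝ (fun y => f.1 (c y)) y (c.symm w) := by
  have h1 : HasDerivAt (fun t : ℝ => y + t • c.symm w) (c.symm w) 0 := by
    simpa using ((hasDerivAt_id (0 : ℝ)).smul_const (c.symm w)).const_add y
  have h2 := ((f.2 c).differentiable (by simp) (y + (0 : ℝ) • c.symm w)).hasFDerivAt
  have h3 := h2.comp_hasDerivAt (0 : ℝ) h1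
  have h4 : (fun t : ℝ => f.1 (c y + t • w))
      = (fun y => f.1 (c y)) ∘ fun t : ℝ => y + t • c.symm w := by
    ext t
    simp
  rw [← h4, zero_smul, add_zero] at h3
  exact (hasDerivAt_dirDeriv f w (c y)).unique h3

theorem dirDeriv_mem_smoothFun (f : SmoothFun J ℝ) (w : J) : dirDeriv w f.1 ∈ SmoothFun J ℝ := by
  intro c
  simp only [dirDeriv_eq_fderiv]
  exact ((f.2 c).fderiv_right (by simp)).clm_apply contDiff_const

variable (J) in
/-- The directional derivatives as operators on smooth functions. -/
noncomputable def dirDerivHom : J →ₗ[ℝ] Module.End ℝ (SmoothFun J ℝ) where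
  toFun w :=
    { toFun := fun f => ⟨dirDeriv w f.1, dirDeriv_mem_smoothFun f w⟩
      map_add' := fun f g => Subtype.ext <| funext fun x =>
        (hasDerivAt_dirDeriv (f + g) w x).unique
          ((hasDerivAt_dirDeriv f w x).add (hasDerivAt_dirDeriv g w x))
      map_smul' := fun r f => Subtype.ext <| funext fun x =>
        (hasDerivAt_dirDeriv (r • f) w x).unique ((hasDerivAt_dirDeriv f w x).const_smul r) }
  map_add' u v := by
    ext f x
    have hc := (Module.finBasis ℝ J).equivFun.symm.apply_symm_apply x
    change dirDeriv (u + v) f.1 x = dirDeriv u f.1 x + dirDeriv v f.1 x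
    rw [← hc]
    simp only [dirDeriv_eq_fderiv, map_add]
  map_smul' r v := by
    ext f x
    have hc := (Module.finBasis ℝ J).equivFun.symm.apply_symm_apply x
    change dirDeriv (r • v) f.1 x = r * dirDeriv v f.1 x
    rw [← hc]
    simp only [dirDeriv_eq_fderiv, map_smul, smul_eq_mul]

theorem dirDerivHom_coe (w : J) (f : SmoothFun J ℝ) :
    (dirDerivHom J w f).1 = dirDeriv w f.1 := rfl

theorem dirDerivHom_linearFun_mul (φ : J →ₗ[ℝ] ℝ) (w : J) (f : SmoothFun J ℝ) :
    dirDerivHom J w (linearFun J φ * f) = φ w • f + linearFun J φ * dirDerivHom J w f := by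
  refine Subtype.ext (funext fun x => ?_)
  have h1 : HasDerivAt (fun t : ℝ => φ (x + t • w)) (φ w) 0 := by
    simpa using ((hasDerivAt_id (0 : ℝ)).mul_const (φ w)).const_add (φ x)
  have h2 := h1.mul (hasDerivAt_dirDeriv f w x)
  refine (hasDerivAt_dirDeriv (linearFun J φ * f) w x).unique (h2.congr_deriv ?_)
  simp only [zero_smul, add_zero]
  rfl

/-- By Hadamard's lemma `f = f(x) + ∑ (φᵢ - φᵢ(x)) Gᵢ` with `Gᵢ` smooth on all of `J`. The operator
passes through the factors `φᵢ - φᵢ(x)`, which vanish at `x`. No continuity or locality is assumed.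
-/
theorem eq_zero_of_commute_linearFun (O : Module.End ℝ (SmoothFun J ℝ))
    (hO : ∀ φ f, O (linearFun J φ * f) = linearFun J φ * O f) (h1 : O 1 = 0) : O = 0 := by
  ext f x
  let c := (Module.finBasis ℝ J).equivFun.symm
  obtain ⟨g, hg, hfg⟩ := exists_contDiff_sub_eq_sum (fun y => f.1 (c y)) (f.2 c) (c.symm x)
  let G : Fin (Module.finrank ℝ J) → SmoothFun J ℝ :=
    fun i => ⟨fun z => g i (c.symm z), mem_smoothFun_of_coordinates (hg i) c⟩
  let φ : Fin (Module.finrank ℝ J) → J →ₗ[ℝ] ℝ := fun i => (Module.finBasis ℝ J).coord i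
  have hf : f = f.1 x • (1 : SmoothFun J ℝ)
      + ∑ i, (linearFun J (φ i) * G i - φ i x • G i) := by
    refine Subtype.ext (funext fun z => ?_)
    have h := hfg (c.symm z)
    simp only [c.apply_symm_apply] at h
    rw [h]
    simp only [AddMemClass.coe_add, AddSubmonoidClass.coe_finsetSum, Pi.add_apply,
      Finset.sum_apply, AddSubgroupClass.coe_sub, Pi.sub_apply, sub_mul]
    congr 1
    exact (mul_one _).symm
  rw [hf, map_add, map_smul, h1, map_sum]
  simp only [map_sub, map_smul, hO]
  simp only [AddMemClass.coe_add, AddSubmonoidClass.coe_finsetSum, Pi.add_apply,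
      Finset.sum_apply, AddSubgroupClass.coe_sub, Pi.sub_apply]
  have h2 : ∀ i, (linearFun J (φ i) * O (G i)).1 x = (φ i x • O (G i)).1 x := fun i => rfl
  simp [h2]

/-- The smooth functions on `J` as a differential model. -/
noncomputable def IsCartanInvolution.smoothModel {α : J →ₙₐ[ℝ] J} (hα : IsCartanInvolution α) :
    DifferentialModel (traceForm J) (SmoothFun J ℝ) where
  μ := linearFun J ∘ₗ traceForm J
  d := dirDerivHom J
  d_one w := Subtype.ext (funext fun x =>
    (hasDerivAt_dirDeriv 1 w x).unique (hasDerivAt_const 0 (1 : ℝ)))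
  d_mul w v f := dirDerivHom_linearFun_mul _ _ _
  rigid O hO h1 := by
    refine eq_zero_of_commute_linearFun O (fun φ f => ?_) h1
    -- By nondegeneracy every linear form is some `τ(v, ·)`.
    obtain ⟨v, rfl⟩ := ((traceForm J).toDual hα.nondegenerate).surjective φ
    exact hO v f

end SmoothModel

/-! ### The three-graded realisation and polynomial functions -/

section Realisation

variable {J : Type*} [NonAssocCommRing J] [Module ℝ J] [IsScalarTower ℝ J J]
  [SMulCommClass ℝ J J] [IsCommJordan J]

variable (J) in
/-- The multiple `-(r / 2n) λ Tr` of the trace on the structure algebra. -/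
noncomputable def strCharacter (lam : ℝ) : str J →ₗ[ℝ] ℝ :=
  (-((rank J : ℝ) / (2 * Module.finrank ℝ J)) * lam) • LinearMap.trace ℝ J ∘ₗ (str J).subtype

theorem strCharacter_apply (lam : ℝ) (T : str J) : strCharacter J lam T
    = -((rank J : ℝ) / (2 * Module.finrank ℝ J)) * lam *
      LinearMap.trace ℝ J (T : Module.End ℝ J) := rfl

theorem strCharacter_strComm (lam : ℝ) (S T : str J) : strCharacter J lam (strComm S T) = 0 := by
  rw [strCharacter_apply, strComm, map_sub, LinearMap.trace_mul_comm, sub_self, mul_zero]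

variable [FiniteDimensional ℝ J]

/-- The normalisation `r / 2n` cancels the factor `2n / r` of `trace_opD`. -/
theorem IsCartanInvolution.strCharacter_strD [IsSimpleRing J] {α : J →ₙₐ[ℝ] J}
    (hα : IsCartanInvolution α) (lam : ℝ) (x y : J) :
    strCharacter J lam (strD x y) = -(lam * traceForm J x y) := by
  have hr : (rank J : ℝ) ≠ 0 := by exact_mod_cast (rank_pos J).ne'
  have hn : (Module.finrank ℝ J : ℝ) ≠ 0 := by exact_mod_cast (Module.finrank_pos (R := ℝ)).ne'
  rw [strCharacter_apply, strD, hα.trace_opD]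
  field_simp

/-- The minus signs in `opZero` and `opPlus` come from `[T, v] = -T♯ v` and `[[x, u], v] = -D_{u,x}
v` on `V₋`. The formulas hold in every basis by `opZero_eq` and `opPlus_eq`. -/
theorem IsCartanInvolution.isThreeGradedRealisation {α : J →ₙₐ[ℝ] J}
    (hα : IsCartanInvolution α) (lam : ℝ) {k : ℕ} {e f : Fin k → J}
    (hef : IsDualPair (traceForm J) e f) :
    IsThreeGradedRealisation (coGrading J) (traceCharacter J lam)
      ((symmetricModel J).rep (strCharacter J lam) hef (strCharacter_strComm lam)) where
  apply_minus X := by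
    ext a
    have h : minusEquiv J (X : Co J).minus = X := (minusEquiv J).apply_symm_apply X
    rw [DifferentialModel.rep_apply, X.2.1, X.2.2, symmetricModel_μ, h]
    simp [symMul]
  apply_zero m b X := by
    ext a
    have hb := hα.isDualPair (b.map (minusEquiv J).symm)
    have h : ∀ i, (coGrading J).lieMinus X (b i) = -minusEquiv J
        (sharpEnd J (X : Co J).zero ((minusEquiv J).symm (b i))) := by
      intro i
      refine ((minusEquiv J).symm_apply_eq.mp ?_).trans (map_neg _ _)
      change sharpEnd J (b i : Co J).zero (X : Co J).minus
        - sharpEnd J (X : Co J).zero (b i : Co J).minus = _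
      rw [X.2.2, map_zero, zero_sub]
      rfl
    rw [DifferentialModel.rep_apply, X.2.1, X.2.2, (symmetricModel J).opZero_eq _ hef hb,
      DifferentialModel.opZero_apply]
    simp only [map_zero, LinearMap.zero_apply, zero_mul, zero_add, add_zero, LinearMap.add_apply,
      LinearMap.smul_apply, LinearMap.sum_apply, Module.End.mul_apply, h, symMul, map_neg,
      LinearMap.mulLeft_apply, neg_mul, Finset.sum_neg_distrib, hα.symmetricModel_d,
      symmetricModel_μ, sub_eq_add_neg]
    rfl
  apply_plus m b X := by
    ext a
    have hb := hα.isDualPair (b.map (minusEquiv J).symm)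
    have h : ∀ i j, (coGrading J).lieMinus ((coGrading J).lieZero X (b i)) (b j)
        = -minusEquiv J (opD ((minusEquiv J).symm (b i)) (X : Co J).plus
          ((minusEquiv J).symm (b j))) := by
      intro i j
      refine ((minusEquiv J).symm_apply_eq.mp ?_).trans (map_neg _ _)
      change sharpEnd J (b j : Co J).zero ⁅(X : Co J), (b i : Co J)⁆.minus
        - sharpEnd J ⁅(X : Co J), (b i : Co J)⁆.zero (b j : Co J).minus = _
      rw [(b j).2.2, Co.lie_zero, X.2.1, (b i).2.1]
      simp only [ZeroMemClass.coe_zero, map_zero, LinearMap.zero_apply, zero_mul, mul_zero,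
        sub_zero, zero_add, zero_sub, map_sub, sharpEnd_opD]
      simp [opD, minusEquiv_symm_apply]
    have hχ : ∀ i, (traceCharacter J lam).toLinearMap ((coGrading J).lieZero X (b i))
        = strCharacter J lam (strD (X : Co J).plus ((minusEquiv J).symm (b i))) := by
      intro i
      change strCharacter J lam ⁅(X : Co J), (b i : Co J)⁆.zero = _
      congr 1
      refine Subtype.ext ?_
      rw [Co.lie_zero, X.2.1, (b i).2.1]
      simp [opD, strD, minusEquiv_symm_apply]
    rw [DifferentialModel.rep_apply, X.2.1, X.2.2, (symmetricModel J).opPlus_eq _ hef hb,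
      DifferentialModel.opPlus_apply]
    simp only [map_zero, LinearMap.zero_apply, zero_mul, add_zero, LinearMap.add_apply,
      LinearMap.smul_apply, LinearMap.sum_apply, Module.End.mul_apply, h, hχ, symMul, map_neg,
      LinearMap.mulLeft_apply, neg_mul, Finset.sum_neg_distrib, hα.symmetricModel_d,
      symmetricModel_μ, sub_eq_add_neg, smul_neg]
    rfl

theorem traceIdent_ι (v : J) : traceIdent J (SymmetricAlgebra.ι ℝ _ (minusEquiv J v))
    = linearFun J (traceForm J v) := SymmetricAlgebra.lift_ι_apply _ _

theorem IsCartanInvolution.range_traceIdent {α : J →ₙₐ[ℝ] J} (hα : IsCartanInvolution α) :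
    (traceIdent J).range = Algebra.adjoin ℝ (Set.range (linearFun J)) := by
  refine le_antisymm ?_ (Algebra.adjoin_le ?_)
  · rintro _ ⟨a, rfl⟩
    change traceIdent J a ∈ _
    induction a using SymmetricAlgebra.induction with
    | algebraMap r =>
      rw [AlgHom.commutes]
      exact Subalgebra.algebraMap_mem _ r
    | ι X =>
      obtain ⟨v, rfl⟩ := (minusEquiv J).surjective X
      rw [traceIdent_ι]
      exact Algebra.subset_adjoin ⟨_, rfl⟩
    | mul a b ha hb =>
      rw [map_mul]
      exact mul_mem ha hb
    | add a b ha hb =>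
      rw [map_add]
      exact add_mem ha hb
  · rintro _ ⟨φ, rfl⟩
    obtain ⟨v, rfl⟩ := ((traceForm J).toDual hα.nondegenerate).surjective φ
    exact ⟨_, traceIdent_ι v⟩

/-- Evaluating at the point with coordinates `y` in the dual basis is evaluating the polynomial at
`y`; a real polynomial with no nonzero value is zero. -/
theorem IsCartanInvolution.traceIdent_injective {α : J →ₙₐ[ℝ] J} (hα : IsCartanInvolution α) :
    Function.Injective (traceIdent J) := by
  rw [injective_iff_map_eq_zero]
  intro p hp
  let b := Module.finBasis ℝ J
  let E := SymmetricAlgebra.equivMvPolynomial (b.map (minusEquiv J))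
  have key : ∀ y : Fin (Module.finrank ℝ J) → ℝ, MvPolynomial.eval y (E p) = 0 := by
    intro y
    let x : J := ∑ j, y j • hα.dual b j
    let ev : SmoothFun J ℝ →ₐ[ℝ] ℝ :=
      (Pi.evalAlgHom ℝ (fun _ : J => ℝ) x).comp (SmoothFun J ℝ).val
    have h : ev.comp (traceIdent J) = (MvPolynomial.aeval y).comp E.toAlgHom := by
      refine SymmetricAlgebra.algHom_ext ((b.map (minusEquiv J)).ext fun i => ?_)
      change ev (traceIdent J (SymmetricAlgebra.ι ℝ _ (b.map (minusEquiv J) i)))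
        = MvPolynomial.aeval y (E (SymmetricAlgebra.ι ℝ _ (b.map (minusEquiv J) i)))
      rw [SymmetricAlgebra.equivMvPolynomial_ι_apply, MvPolynomial.aeval_X, Module.Basis.map_apply,
        traceIdent_ι]
      change traceForm J (b i) (∑ j, y j • hα.dual b j) = y i
      simp [hα.traceForm_dual]
    have h2 := AlgHom.congr_fun h p
    rw [AlgHom.comp_apply, hp, map_zero] at h2
    exact h2.symm
  have hE : E p = 0 := MvPolynomial.funext fun y => by rw [key, map_zero]
  exact E.map_eq_zero_iff.mp hE

end Realisation

/-! ### The Cartan involution of `co(J)` -/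

section CartanTwist

variable {J : Type*} [NonAssocCommRing J] [Module ℝ J] [IsScalarTower ℝ J J]
  [SMulCommClass ℝ J J] {α : J →ₙₐ[ℝ] J}

variable (α) in
/-- The operator `α T α`. -/
def conjEnd : Module.End ℝ J →ₗ[ℝ] Module.End ℝ J where
  toFun T := (α : J →ₗ[ℝ] J) ∘ₗ T ∘ₗ (α : J →ₗ[ℝ] J)
  map_add' S T := by
    ext z
    simp
  map_smul' c T := by
    ext z
    simp

@[simp] theorem conjEnd_apply (T : Module.End ℝ J) (z : J) : conjEnd α T z = α (T (α z)) := rfl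

theorem IsCartanInvolution.map_one (hα : IsCartanInvolution α) : α 1 = 1 := by
  have := map_mul α (α 1) 1
  rwa [mul_one, hα.involutive, one_mul, eq_comm] at this

theorem IsCartanInvolution.conjEnd_opD (hα : IsCartanInvolution α) (x y : J) :
    conjEnd α (opD x y) = opD (α x) (α y) := by
  ext z
  simp [opD_apply, hα.involutive]

theorem IsCartanInvolution.conjEnd_mem (hα : IsCartanInvolution α) {T : Module.End ℝ J}
    (hT : T ∈ str J) : conjEnd α T ∈ str J := by
  refine Submodule.span_induction (p := fun T _ => conjEnd α T ∈ str J) ?_ ?_ ?_ ?_ hT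
  · rintro _ ⟨x, y, rfl⟩
    rw [hα.conjEnd_opD]
    exact (strD _ _).2
  · simp
  · intro S T _ _ hS hT
    rw [map_add]
    exact add_mem hS hT
  · intro c T _ hT
    rw [map_smul]
    exact Submodule.smul_mem _ c hT

theorem IsCartanInvolution.sharpEnd_conjEnd (hα : IsCartanInvolution α) (T : Module.End ℝ J) :
    sharpEnd J (conjEnd α T) = conjEnd α (sharpEnd J T) := by
  ext z
  simp [sharpEnd_apply, hα.involutive, hα.map_one]

variable [IsCommJordan J]

/-- The Cartan involution `(u, T, v) ↦ (-α v, -α T♯ α, -α u)` of `co(J)`. -/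
def IsCartanInvolution.theta (hα : IsCartanInvolution α) : Co J ≃ₗ⁅ℝ⁆ Co J :=
  let g : Co J → Co J := fun X => Co.mk (-α X.minus)
    ⟨-conjEnd α (sharpEnd J X.zero), neg_mem (hα.conjEnd_mem (sharpEnd_mem J X.zero.2))⟩
    (-α X.plus)
  have hg : ∀ X, g (g X) = X := fun X => Co.ext_iff' (by simp [g, hα.involutive])
    (by
      ext z
      simp only [g, Co.zero_mk, map_neg, hα.sharpEnd_conjEnd, sharpEnd_sharpEnd, neg_neg]
      simp [hα.involutive])
    (by simp [g, hα.involutive])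
  { toFun := g
    map_add' := fun X Y => Co.ext_iff' (by simp [g]; abel) (by simp [g]; abel) (by simp [g]; abel)
    map_smul' := fun c X => Co.ext_iff' (by simp [g]) (by simp [g]) (by simp [g])
    map_lie' := fun {X Y} => by
      refine Co.ext_iff' ?_ ?_ ?_
      · simp [g, Co.lie_plus, Co.lie_minus, hα.involutive]
      · ext z
        -- The middle component of the involution is `-α T♯ α`, so the formula for the bracket under
        -- `♯` has to be conjugated and negated.
        have h := congrArg (fun T => (-conjEnd α T) z) (Co.lie_sharp X Y)
        refine h.trans ?_
        simp only [g, Co.lie_zero, Co.zero_mk, Co.plus_mk, Co.minus_mk, map_add, map_sub,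
          hα.conjEnd_opD]
        simp [hα.involutive, opD_apply]
        abel
      · simp only [g, Co.lie_minus, Co.zero_mk, Co.minus_mk, map_neg, hα.sharpEnd_conjEnd,
          sharpEnd_sharpEnd, Co.lie_plus]
        simp [hα.involutive]
    invFun := g
    left_inv := hg
    right_inv := hg }

theorem IsCartanInvolution.theta_apply (hα : IsCartanInvolution α) (X : Co J) :
    hα.theta X = Co.mk (-α X.minus)
      ⟨-conjEnd α (sharpEnd J X.zero), neg_mem (hα.conjEnd_mem (sharpEnd_mem J X.zero.2))⟩
      (-α X.plus) := rfl

theorem IsCartanInvolution.theta_theta (hα : IsCartanInvolution α) (X : Co J) :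
    hα.theta (hα.theta X) = X := hα.theta.left_inv X

theorem IsCartanInvolution.theta_mk_strD (hα : IsCartanInvolution α) (u x y v : J) :
    hα.theta (Co.mk u (strD x y) v) = Co.mk (-α v) (-strD (α y) (α x)) (-α u) := by
  rw [hα.theta_apply]
  congr 1
  refine Subtype.ext ?_
  change -conjEnd α (sharpEnd J (opD x y)) = -opD (α y) (α x)
  rw [sharpEnd_opD, hα.conjEnd_opD]

end CartanTwist

/-! ### Complex-valued functions -/

section Complexification

variable {J : Type*} [NonAssocCommRing J] [Module ℝ J] [IsScalarTower ℝ J J]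
  [SMulCommClass ℝ J J] [FiniteDimensional ℝ J]

variable (J) in
/-- The real part of a smooth function. -/
def reFun : SmoothFun J ℂ →ₗ[ℝ] SmoothFun J ℝ where
  toFun f := ⟨fun x => (f.1 x).re, fun c => Complex.reCLM.contDiff.comp (f.2 c)⟩
  map_add' _ _ := rfl
  map_smul' r f := Subtype.ext (funext fun x => Complex.smul_re r (f.1 x))

variable (J) in
/-- The imaginary part of a smooth function. -/
def imFun : SmoothFun J ℂ →ₗ[ℝ] SmoothFun J ℝ where
  toFun f := ⟨fun x => (f.1 x).im, fun c => Complex.imCLM.contDiff.comp (f.2 c)⟩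
  map_add' _ _ := rfl
  map_smul' r f := Subtype.ext (funext fun x => Complex.smul_im r (f.1 x))

/-- The smooth function with given real and imaginary parts. -/
noncomputable def mkComplexFun (f g : SmoothFun J ℝ) : SmoothFun J ℂ :=
  ⟨fun x => f.1 x + Complex.I * g.1 x, fun c =>
    (Complex.ofRealCLM.contDiff.comp (f.2 c)).add
      (contDiff_const.mul (Complex.ofRealCLM.contDiff.comp (g.2 c)))⟩

theorem smoothFun_complex_ext {f g : SmoothFun J ℂ} (h1 : reFun J f = reFun J g)
    (h2 : imFun J f = imFun J g) : f = g :=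
  Subtype.ext (funext fun x => Complex.ext (congrFun (congrArg Subtype.val h1) x)
    (congrFun (congrArg Subtype.val h2) x))

@[simp] theorem reFun_mkComplexFun (f g : SmoothFun J ℝ) : reFun J (mkComplexFun f g) = f :=
  Subtype.ext (funext fun x => by simp [reFun, mkComplexFun])

@[simp] theorem imFun_mkComplexFun (f g : SmoothFun J ℝ) : imFun J (mkComplexFun f g) = g :=
  Subtype.ext (funext fun x => by simp [imFun, mkComplexFun])

theorem reFun_smul (z : ℂ) (f : SmoothFun J ℂ) :
    reFun J (z • f) = z.re • reFun J f - z.im • imFun J f :=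
  Subtype.ext (funext fun x => Complex.mul_re z (f.1 x))

theorem imFun_smul (z : ℂ) (f : SmoothFun J ℂ) :
    imFun J (z • f) = z.re • imFun J f + z.im • reFun J f :=
  Subtype.ext (funext fun x => Complex.mul_im z (f.1 x))

/-- The complex-linear extension of an operator on real-valued smooth functions. -/
noncomputable def complexifyEnd :
    Module.End ℝ (SmoothFun J ℝ) →ₗ⁅ℝ⁆ Module.End ℂ (SmoothFun J ℂ) where
  toFun O :=
    { toFun := fun f => mkComplexFun (O (reFun J f)) (O (imFun J f))
      map_add' := fun f g => smoothFun_complex_ext (by simp) (by simp)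
      map_smul' := fun z f => smoothFun_complex_ext (by simp [reFun_smul, imFun_smul])
        (by simp [reFun_smul, imFun_smul]) }
  map_add' O O' := by
    refine LinearMap.ext fun f => smoothFun_complex_ext ?_ ?_ <;> simp
  map_smul' c O := by
    refine LinearMap.ext fun f => smoothFun_complex_ext ?_ ?_ <;> simp
  map_lie' {O O'} := by
    refine LinearMap.ext fun f => smoothFun_complex_ext ?_ ?_ <;> simp [Ring.lie_def]

theorem dirDeriv_complex (f : SmoothFun J ℂ) (w x : J) : dirDeriv w f.1 x
    = dirDeriv w (reFun J f).1 x + Complex.I * dirDeriv w (imFun J f).1 x := by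
  have h := (hasDerivAt_dirDeriv (reFun J f) w x).ofReal_comp.add
    ((hasDerivAt_dirDeriv (imFun J f) w x).ofReal_comp.const_mul Complex.I)
  have hf : (fun t : ℝ => f.1 (x + t • w)) = (fun t : ℝ => (((reFun J f).1 (x + t • w) : ℝ) : ℂ))
      + fun t : ℝ => Complex.I * (((imFun J f).1 (x + t • w) : ℝ) : ℂ) := by
    ext t
    simp only [Pi.add_apply]
    rw [mul_comm]
    exact (Complex.re_add_im _).symm
  rw [← hf] at h
  exact h.deriv

end Complexification

/-! ### Rescaling the graded pieces by `∓ i` -/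

section GradedTwist

variable {J : Type*} [NonAssocCommRing J] [Module ℝ J] [IsScalarTower ℝ J J]
  [SMulCommClass ℝ J J] [IsCommJordan J]

variable {V : Type*} [AddCommGroup V] [Module ℂ V] [Module ℝ V] [IsScalarTower ℝ ℂ V]

/-- Multiplying the action of `V±` in a complex representation by `∓ i`. -/
noncomputable def gradedTwist (φ : Co J →ₗ⁅ℝ⁆ Module.End ℂ V) : Co J →ₗ⁅ℝ⁆ Module.End ℂ V where
  toFun X := -(Complex.I • φ (Co.mk X.plus 0 0)) + φ (Co.mk 0 X.zero 0)
    + Complex.I • φ (Co.mk 0 0 X.minus)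
  map_add' X Y := by
    have h1 : Co.mk (X + Y).plus 0 0 = Co.mk X.plus 0 0 + Co.mk Y.plus 0 0 :=
      Co.ext_iff' (by simp) (by simp) (by simp)
    have h2 : Co.mk 0 (X + Y).zero 0 = Co.mk 0 X.zero 0 + Co.mk 0 Y.zero 0 :=
      Co.ext_iff' (by simp) (by simp) (by simp)
    have h3 : Co.mk 0 0 (X + Y).minus = Co.mk 0 0 X.minus + Co.mk 0 0 Y.minus :=
      Co.ext_iff' (by simp) (by simp) (by simp)
    rw [h1, h2, h3, map_add, map_add, map_add]
    module
  map_smul' c X := by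
    have h1 : Co.mk (c • X).plus 0 0 = c • Co.mk X.plus 0 0 :=
      Co.ext_iff' (by simp) (by simp) (by simp)
    have h2 : Co.mk 0 (c • X).zero 0 = c • Co.mk 0 X.zero 0 :=
      Co.ext_iff' (by simp) (by simp) (by simp)
    have h3 : Co.mk 0 0 (c • X).minus = c • Co.mk 0 0 X.minus :=
      Co.ext_iff' (by simp) (by simp) (by simp)
    rw [h1, h2, h3, map_smul, map_smul, map_smul, RingHom.id_apply, smul_comm Complex.I,
      smul_comm Complex.I]
    module
  map_lie' {X Y} := by
    have hz : ⁅X, Y⁆.zero = strComm X.zero Y.zero + strD X.plus Y.minus - strD Y.plus X.minus := rfl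
    -- Brackets within `V₊` or within `V₋` would acquire the factor `-1`, but they vanish; between
    -- `V₊` and `V₋` the factor is `(-i)·i = 1`.
    have e0 : ∀ u v : J, ⁅Co.mk u 0 0, Co.mk v 0 0⁆ = 0 := fun u v =>
      Co.ext_iff' (by simp [Co.lie_plus]) (by simp [Co.lie_zero, opD]) (by simp [Co.lie_minus])
    have e1 : ∀ u v : J, ⁅Co.mk 0 0 u, Co.mk 0 0 v⁆ = 0 := fun u v =>
      Co.ext_iff' (by simp [Co.lie_plus]) (by simp [Co.lie_zero, opD]) (by simp [Co.lie_minus])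
    have hp : Co.mk ⁅X, Y⁆.plus 0 0 = ⁅Co.mk 0 X.zero 0, Co.mk Y.plus 0 0⁆
        + ⁅Co.mk X.plus 0 0, Co.mk 0 Y.zero 0⁆ :=
      Co.ext_iff' (by simp [Co.lie_plus, sub_eq_add_neg]) (by simp [Co.lie_zero, opD])
        (by simp [Co.lie_minus])
    have hm : Co.mk 0 0 ⁅X, Y⁆.minus = ⁅Co.mk 0 X.zero 0, Co.mk 0 0 Y.minus⁆
        + ⁅Co.mk 0 0 X.minus, Co.mk 0 Y.zero 0⁆ :=
      Co.ext_iff' (by simp [Co.lie_plus]) (by simp [Co.lie_zero, opD])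
        (by simp [Co.lie_minus]; abel)
    have h0 : Co.mk 0 ⁅X, Y⁆.zero 0 = ⁅Co.mk 0 X.zero 0, Co.mk 0 Y.zero 0⁆
        + ⁅Co.mk X.plus 0 0, Co.mk 0 0 Y.minus⁆ + ⁅Co.mk 0 0 X.minus, Co.mk Y.plus 0 0⁆ :=
      Co.ext_iff' (by simp [Co.lie_plus])
        (by
          simp [Co.lie_zero, opD, hz, strComm, strD]
          abel)
        (by simp [Co.lie_minus])
    have k0 := fun u v : J => (φ.map_lie (Co.mk u 0 0) (Co.mk v 0 0)).symm
    have k1 := fun u v : J => (φ.map_lie (Co.mk 0 0 u) (Co.mk 0 0 v)).symm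
    simp only [e0, map_zero] at k0
    simp only [e1, map_zero] at k1
    rw [hp, hm, h0]
    simp only [map_add, LieHom.map_lie, add_lie, lie_add, neg_lie, lie_neg, smul_lie, lie_smul,
      k0, k1, smul_zero, smul_smul, Complex.I_mul_I, smul_add, smul_neg, neg_smul, one_smul, neg_neg,
      neg_zero, add_zero, zero_add]
    abel

end GradedTwist

/-! ### Explicit differential operators and the Bessel operator -/

section Formulas

variable {J : Type*} [NonAssocCommRing J] [Module ℝ J] [IsScalarTower ℝ J J]
  [SMulCommClass ℝ J J] [FiniteDimensional ℝ J] [IsCommJordan J] {α : J →ₙₐ[ℝ] J}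

theorem sum_mul_dirDeriv {m : ℕ} {e f : Fin m → J} (hfe : IsDualPair (traceForm J) f e) (w : J)
    (g : SmoothFun J ℝ) (x : J) :
    ∑ i, traceForm J (e i) w * dirDeriv (f i) g.1 x = dirDeriv w g.1 x := by
  have h : dirDerivHom J w g = ∑ i, traceForm J w (e i) • dirDerivHom J (f i) g := by
    conv_lhs => rw [← hfe w]
    simp
  have h2 := congrFun (congrArg Subtype.val h) x
  rw [dirDerivHom_coe] at h2
  rw [h2]
  simp only [AddSubmonoidClass.coe_finsetSum, Finset.sum_apply]
  exact Finset.sum_congr rfl fun i _ => by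
    rw [traceForm_comm]
    rfl

/-- Since `τ(T♯ eᵢ, x) = τ(eᵢ, T x)`, the first order part is the linear vector field `-T x`. -/
theorem IsCartanInvolution.opZero_smooth [Nontrivial J] (hα : IsCartanInvolution α)
    (χ : str J →ₗ[ℝ] ℝ) {m : ℕ} {e f : Fin m → J} (hfe : IsDualPair (traceForm J) f e)
    (T : str J) (g : SmoothFun J ℝ) (x : J) :
    (hα.smoothModel.opZero χ e f T g).1 x
      = χ T * g.1 x - dirDeriv ((T : Module.End ℝ J) x) g.1 x := by
  rw [DifferentialModel.opZero_apply, ← sum_mul_dirDeriv hfe]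
  simp only [AddSubgroupClass.coe_sub, AddSubmonoidClass.coe_finsetSum, Finset.sum_apply,
    Pi.sub_apply, ← hα.traceForm_sharpEnd T.2]
  rfl

/-- The character gives `-λ₀ τ(v, eᵢ)`, and `τ(D_{a,v} c, x) = 2 τ(v, P_{a,c} x)` absorbs the factor
`1/2`. -/
theorem IsCartanInvolution.opPlus_smooth [IsSimpleRing J] (hα : IsCartanInvolution α)
    (lam : ℝ) {m : ℕ} (e f : Fin m → J) (v : J) (g : SmoothFun J ℝ) (x : J) :
    (hα.smoothModel.opPlus (strCharacter J lam) e f v g).1 x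
      = -(lam * ∑ i, traceForm J v (e i) * dirDeriv (f i) g.1 x
        + ∑ i, ∑ j, traceForm J v (opP (e i) (e j) x)
          * dirDeriv (f j) (dirDeriv (f i) g.1) x) := by
  have h : (hα.smoothModel.opPlus (strCharacter J lam) e f v g).1 x
      = ∑ i, strCharacter J lam (strD v (e i)) * dirDeriv (f i) g.1 x
        - (1 / 2 : ℝ) * ∑ i, ∑ j, traceForm J (opD (e i) v (e j)) x
          * dirDeriv (f j) (dirDeriv (f i) g.1) x := by
    rw [DifferentialModel.opPlus_apply]
    change (∑ i, _ : SmoothFun J ℝ).1 x - (1 / 2 : ℝ) * (∑ i, ∑ j, _ : SmoothFun J ℝ).1 x = _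
    simp only [AddSubmonoidClass.coe_finsetSum, Finset.sum_apply]
    rfl
  rw [h, neg_add, ← sub_eq_add_neg]
  congr 1
  · simp [hα.strCharacter_strD, Finset.mul_sum, mul_assoc]
  · simp only [hα.traceForm_opD_eq_opP, Finset.mul_sum]
    refine Finset.sum_congr rfl fun i _ => Finset.sum_congr rfl fun j _ => ?_
    ring

theorem opP_comm (x y : J) : opP x y = opP y x := by
  rw [opP, opP, mul_comm x y, add_comm (mulOp x * mulOp y)]

theorem IsCartanInvolution.traceForm_besselOperator (hα : IsCartanInvolution α) (lam : ℝ) {m : ℕ}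
    (b : Module.Basis (Fin m) ℝ J) (v : J) (g : J → ℝ) (x : J) :
    traceForm J v (besselOperator hα lam b g x)
      = lam * ∑ i, traceForm J v (hα.dual b i) * dirDeriv (b i) g x
        + ∑ i, ∑ j, traceForm J v (opP (hα.dual b i) (hα.dual b j) x)
          * dirDeriv (b j) (dirDeriv (b i) g) x := by
  rw [besselOperator, map_add, add_comm]
  simp only [map_sum, map_smul, smul_eq_mul]
  congr 1
  · simp only [mul_comm]
  · rw [Finset.sum_comm]
    refine Finset.sum_congr rfl fun i _ => Finset.sum_congr rfl fun j _ => ?_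
    rw [opP_comm, mul_comm]

/-- As `T♯` is the `τ`-adjoint of `T`, the adjoint for `(·|·)` is `α T♯ α`, and nondegeneracy makes
adjoints unique. -/
theorem IsCartanInvolution.eq_conjEnd_sharpEnd [Nontrivial J] (hα : IsCartanInvolution α)
    {T : Module.End ℝ J} (hT : T ∈ str J) {S : Module.End ℝ J}
    (hS : ∀ a b : J, cartanForm α (T a) b = cartanForm α a (S b)) :
    S = conjEnd α (sharpEnd J T) := by
  ext b
  refine hα.equiv.injective (sub_eq_zero.mp (hα.nondegenerate.2 _ fun a => ?_))
  have h := hS a b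
  change traceForm J a (α (S b) - α (conjEnd α (sharpEnd J T) b)) = 0
  rw [cartanForm, cartanForm] at h
  rw [map_sub, ← h, conjEnd_apply, hα.involutive, traceForm_comm a,
    hα.traceForm_sharpEnd hT, traceForm_comm, sub_self]

end Formulas

end JordanBessel


/-! ### Assembly of the representations -/

set_option maxHeartbeats 1000000 in
theorem mainTheorem8 {J : Type*} [NonAssocCommRing J] [Module ℝ J] [IsScalarTower ℝ J J]
    [SMulCommClass ℝ J J] [FiniteDimensional ℝ J] [IsCommJordan J] [IsSimpleRing J]
    (α : J →ₙₐ[ℝ] J) (hα : IsCartanInvolution α) (hfix : IsSimpleRing (fixedPoints α))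
    (lam : ℝ) :
    -- the polynomial realisation `π`, its extension `σ` to smooth functions on `J`, the Cartan
    -- involution `θ`, the representation `π'` and the representation `ρ` on complex functions
    ∃ (π : Co J →ₗ⁅ℝ⁆ Module.End ℝ (SymmetricAlgebra ℝ (coGrading J).minus))
      (σ : Co J →ₗ⁅ℝ⁆ Module.End ℝ (SmoothFun J ℝ))
      (θ : Co J ≃ₗ⁅ℝ⁆ Co J)
      (π' : Co J →ₗ⁅ℝ⁆ Module.End ℝ (SmoothFun J ℝ))
      (ρ : Co J →ₗ⁅ℝ⁆ Module.End ℂ (SmoothFun J ℂ)),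
      -- `π` is the three-graded realisation for the character `-(r / 2n) λ₀ Tr`
      IsThreeGradedRealisation (coGrading J) (traceCharacter J lam) π ∧
      -- `v ↦ τ(v, ·)` identifies the symmetric algebra with the polynomial functions on `J`
      Function.Injective (traceIdent J) ∧
      (traceIdent J).range = Algebra.adjoin ℝ (Set.range (linearFun J)) ∧
      -- `σ` extends `π` along this identification
      (∀ (X : Co J) (p : SymmetricAlgebra ℝ (coGrading J).minus),
        σ X (traceIdent J p) = traceIdent J (π X p)) ∧
      (∀ (v : J) (f : SmoothFun J ℝ) (x : J)
          (e : Module.Basis (Fin (Module.finrank ℝ J)) ℝ J),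
        (σ (Co.mk v 0 0) f).1 x = -traceForm J v (besselOperator hα lam e f.1 x)) ∧
      -- `θ` is the Cartan involution of `co(J)` and `π'` is `σ` twisted by it
      (∀ X, θ (θ X) = X) ∧
      (∀ u x y v : J, θ (Co.mk u (strD x y) v)
        = Co.mk (-α v) (-strD (α y) (α x)) (-α u)) ∧
      (∀ X, π' X = σ (θ X)) ∧
      -- the explicit form of `π'`
      (∀ (u : J) (f : SmoothFun J ℝ) (x : J),
        (π' (Co.mk u 0 0) f).1 x = -cartanForm α u x * f.1 x) ∧
      (∀ (a b : J) (f : SmoothFun J ℝ) (x : J)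
          (e : Module.Basis (Fin (Module.finrank ℝ J)) ℝ J),
        (π' (Co.mk 0 (strD a b) 0) f).1 x
          = (rank J * lam) / (2 * Module.finrank ℝ J)
              * LinearMap.trace ℝ J (opD (α b) (α a)) * f.1 x
            + ∑ i, traceForm J (e i) (opD (α b) (α a) x) * dirDeriv (hα.dual e i) f.1 x) ∧
      (∀ (v : J) (f : SmoothFun J ℝ) (x : J)
          (e : Module.Basis (Fin (Module.finrank ℝ J)) ℝ J),
        (π' (Co.mk 0 0 v) f).1 x
          = lam * ∑ i, cartanForm α v (e i) * dirDeriv (hα.dual e i) f.1 x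
            + ∑ i, ∑ j, cartanForm α v (opP (e i) (e j) x)
                * dirDeriv (hα.dual e j) (dirDeriv (hα.dual e i) f.1) x) ∧
      -- `V₋` acts through the classical Bessel operator
      (∀ (v : J) (f : SmoothFun J ℝ) (x : J)
          (e : Module.Basis (Fin (Module.finrank ℝ J)) ℝ J),
        (π' (Co.mk 0 0 v) f).1 x = cartanForm α v (besselOperator hα lam e f.1 x)) ∧
      -- `ρ` is the representation of Hilgert, Kobayashi and Möllers
      (∀ (u : J) (f : SmoothFun J ℂ) (x : J),
        (ρ (Co.mk u 0 0) f).1 x = Complex.I * (cartanForm α u x : ℂ) * f.1 x) ∧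
      (∀ (T : str J) (S : Module.End ℝ J) (f : SmoothFun J ℂ) (x : J),
        (∀ a b : J, cartanForm α ((T : Module.End ℝ J) a) b = cartanForm α a (S b)) →
        (ρ (Co.mk 0 T 0) f).1 x = dirDeriv (S x) f.1 x
          + (((rank J * lam) / (2 * Module.finrank ℝ J) * LinearMap.trace ℝ J S : ℝ) : ℂ)
            * f.1 x) ∧
      (∀ (v : J) (f : SmoothFun J ℂ) (x : J)
          (e : Module.Basis (Fin (Module.finrank ℝ J)) ℝ J),
        (ρ (Co.mk 0 0 v) f).1 x = Complex.I
          * ((cartanForm α v (besselOperator hα lam e (fun y => (f.1 y).re) x) : ℂ)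
            + Complex.I * (cartanForm α v (besselOperator hα lam e (fun y => (f.1 y).im) x) : ℂ))) ∧
      -- `ρ` is obtained from `π'` by multiplying the action of `co(J)_{±1}` with `∓ i`
      (∀ (f : SmoothFun J ℝ) (g : SmoothFun J ℂ), (∀ x, g.1 x = (f.1 x : ℂ)) →
        ∀ (u : J) (T : str J) (v x : J),
          (ρ (Co.mk u T v) g).1 x = -Complex.I * ((π' (Co.mk u 0 0) f).1 x : ℂ)
            + ((π' (Co.mk 0 T 0) f).1 x : ℂ)
            + Complex.I * ((π' (Co.mk 0 0 v) f).1 x : ℂ)) := by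
  have : Nontrivial J := inferInstance
  have hfe : ∀ {m : ℕ} (e : Module.Basis (Fin m) ℝ J), IsDualPair (traceForm J) (hα.dual e) e :=
    fun e => hα.isDualPair_symm e
  have hef : ∀ {m : ℕ} (e : Module.Basis (Fin m) ℝ J), IsDualPair (traceForm J) e (hα.dual e) :=
    fun e => hα.isDualPair e
  let b := Module.finBasis ℝ J
  let χ := strCharacter J lam
  have hχ : ∀ S T, χ (strComm S T) = 0 := strCharacter_strComm lam
  -- The same construction in the two models, with one character and one auxiliary basis.
  let π := (symmetricModel J).rep χ (hef b) hχ
  let σ := hα.smoothModel.rep χ (hef b) hχ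
  let π' : Co J →ₗ⁅ℝ⁆ Module.End ℝ (SmoothFun J ℝ) := σ.comp hα.theta.toLieHom
  let ρ := gradedTwist (complexifyEnd.comp π')
  have hα0 : α 0 = 0 := map_zero α
  have hcf : ∀ u w : J, cartanForm α u w = traceForm J (α u) w :=
    fun u w => (hα.traceForm_map_left u w).symm
  have hσ : ∀ (u : J) (T : str J) (v : J) (f : SmoothFun J ℝ) (x : J),
      (σ (Co.mk u T v) f).1 x = (hα.smoothModel.opPlus χ b (hα.dual b) u f).1 x
        + (χ T * f.1 x - dirDeriv ((T : Module.End ℝ J) x) f.1 x)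
        + traceForm J v x * f.1 x := by
    intro u T v f x
    rw [← hα.opZero_smooth χ (hfe b) T f x]
    rfl
  have hσp : ∀ (v : J) (f : SmoothFun J ℝ) (x : J) {m : ℕ} {e f' : Fin m → J},
      IsDualPair (traceForm J) e f' → (σ (Co.mk v 0 0) f).1 x
        = (hα.smoothModel.opPlus χ e f' v f).1 x := by
    intro v f x m e f' h
    have h0 : dirDeriv (0 : J) f.1 x = 0 :=
      congrFun (congrArg Subtype.val (LinearMap.congr_fun (map_zero (dirDerivHom J)) f)) x
    rw [hσ, hα.smoothModel.opPlus_eq χ (hef b) h]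
    simp [h0]
  have hσb : ∀ (v : J) (f : SmoothFun J ℝ) (x : J)
      (e : Module.Basis (Fin (Module.finrank ℝ J)) ℝ J),
      (σ (Co.mk v 0 0) f).1 x = -traceForm J v (besselOperator hα lam e f.1 x) := by
    intro v f x e
    -- The Bessel operator differentiates along `e` and puts the dual basis into `P`, so the dual
    -- pair is taken in the order dual basis, basis.
    rw [hσp v f x (hfe e), hα.opPlus_smooth, hα.traceForm_besselOperator]
  have hπp : ∀ (u : J) (f : SmoothFun J ℝ) (x : J),
      (π' (Co.mk u 0 0) f).1 x = -cartanForm α u x * f.1 x := by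
    intro u f x
    have h : hα.theta (Co.mk u 0 0) = Co.mk 0 0 (-α u) := by
      rw [hα.theta_apply]
      exact Co.ext_iff' (by simp) (by simp) (by simp)
    have h0 : dirDeriv (0 : J) f.1 x = 0 :=
      congrFun (congrArg Subtype.val (LinearMap.congr_fun (map_zero (dirDerivHom J)) f)) x
    change (σ (hα.theta _) f).1 x = _
    rw [h, hσ, hcf]
    simp [h0]
  have hπz : ∀ (T : str J) (f : SmoothFun J ℝ) (x : J), (π' (Co.mk 0 T 0) f).1 x
      = (rank J * lam) / (2 * Module.finrank ℝ J)
          * LinearMap.trace ℝ J (conjEnd α (sharpEnd J T)) * f.1 x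
        + dirDeriv (conjEnd α (sharpEnd J T) x) f.1 x := by
    intro T f x
    have hn : ∀ w, dirDeriv (-w) f.1 x = -dirDeriv w f.1 x := fun w =>
      congrFun (congrArg Subtype.val (LinearMap.congr_fun (map_neg (dirDerivHom J) w) f)) x
    change (σ (hα.theta _) f).1 x = _
    -- The sign in `-α T♯ α` cancels both the sign of the character and that of the vector field.
    rw [hα.theta_apply, hσ]
    simp only [Co.plus_mk, Co.minus_mk, Co.zero_mk, hα0, neg_zero, map_zero, χ,
      strCharacter_apply, map_neg, LinearMap.neg_apply, LinearMap.zero_apply, zero_mul, hn,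
      ZeroMemClass.coe_zero, Pi.zero_apply, zero_add, add_zero]
    ring
  have hπm : ∀ (v : J) (f : SmoothFun J ℝ) (x : J),
      (π' (Co.mk 0 0 v) f).1 x = (σ (Co.mk (-α v) 0 0) f).1 x := by
    intro v f x
    have h : hα.theta (Co.mk 0 0 v) = Co.mk (-α v) 0 0 := by
      rw [hα.theta_apply]
      exact Co.ext_iff' (by simp) (by simp) (by simp)
    change (σ (hα.theta _) f).1 x = _
    rw [h]
  have hπb : ∀ (v : J) (f : SmoothFun J ℝ) (x : J)
      (e : Module.Basis (Fin (Module.finrank ℝ J)) ℝ J),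
      (π' (Co.mk 0 0 v) f).1 x = cartanForm α v (besselOperator hα lam e f.1 x) := by
    intro v f x e
    rw [hπm, hσb _ _ _ e, hcf, map_neg, LinearMap.neg_apply, neg_neg]
  have hρ : ∀ (u : J) (T : str J) (v : J) (f : SmoothFun J ℂ) (x : J),
      (ρ (Co.mk u T v) f).1 x
        = -(Complex.I * ((π' (Co.mk u 0 0) (reFun J f)).1 x
            + Complex.I * (π' (Co.mk u 0 0) (imFun J f)).1 x))
          + ((π' (Co.mk 0 T 0) (reFun J f)).1 x + Complex.I * (π' (Co.mk 0 T 0) (imFun J f)).1 x)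
          + Complex.I * ((π' (Co.mk 0 0 v) (reFun J f)).1 x
            + Complex.I * (π' (Co.mk 0 0 v) (imFun J f)).1 x) := fun u T v f x => rfl
  have hzero : ∀ (f : SmoothFun J ℝ) (x : J), (π' (Co.mk 0 0 0) f).1 x = 0 := by
    intro f x
    have h : (Co.mk 0 0 0 : Co J) = 0 := rfl
    rw [h, map_zero]
    rfl
  have hsplit : ∀ (f : SmoothFun J ℂ) (x : J),
      f.1 x = (reFun J f).1 x + Complex.I * (imFun J f).1 x := by
    intro f x
    rw [mul_comm]
    exact (Complex.re_add_im _).symm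
  refine ⟨π, σ, hα.theta, π', ρ, hα.isThreeGradedRealisation lam _, hα.traceIdent_injective,
    hα.range_traceIdent, fun X p => ?_, hσb, hα.theta_theta, hα.theta_mk_strD, fun X => rfl, hπp,
    fun a b f x e => ?_, fun v f x e => ?_, hπb, fun u f x => ?_, fun T S f x hS => ?_,
    fun v f x e => ?_, fun f g hfg u T v x => ?_⟩
  · exact ((symmetricModel J).map_rep χ (hef b) hα.smoothModel (traceIdent J)
      (fun v => traceIdent_ι v) (fun W h1 hW => submodule_symmetricAlgebra_eq_top W h1
        fun X a ha => by
          obtain ⟨v, rfl⟩ := (minusEquiv J).surjective X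
          exact hW v a ha) hχ X p).symm
  · have h : conjEnd α (sharpEnd J (strD a b)) = opD (α b) (α a) := by
      change conjEnd α (sharpEnd J (opD a b)) = _
      rw [sharpEnd_opD, hα.conjEnd_opD]
    rw [hπz, h, sum_mul_dirDeriv (hfe e)]
  -- Here the coordinates are `τ(eᵢ, ·)`, whose partial derivatives are along the dual basis, so the
  -- pair is taken in the opposite order.
  · rw [hπm, hσp _ _ _ (hef e), hα.opPlus_smooth]
    simp only [hcf, map_neg, LinearMap.neg_apply, neg_mul, Finset.sum_neg_distrib, mul_neg,
      neg_add, neg_neg]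
  · rw [hρ, hzero, hzero, hπp, hπp, hsplit f x]
    push_cast
    ring
  · rw [hρ, hzero, hzero, hπz, hπz, hsplit f x, dirDeriv_complex,
      hα.eq_conjEnd_sharpEnd T.2 hS]
    push_cast
    ring
  · rw [hρ, hzero, hzero, hπb _ _ _ e, hπb _ _ _ e]
    change _ = Complex.I * (((cartanForm α v (besselOperator hα lam e (reFun J f).1 x) : ℝ) : ℂ)
      + Complex.I * ((cartanForm α v (besselOperator hα lam e (imFun J f).1 x) : ℝ) : ℂ))
    simp
  · have hre : reFun J g = f := Subtype.ext (funext fun y => by simp [reFun, hfg])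
    have him : imFun J g = 0 := Subtype.ext (funext fun y => by simp [imFun, hfg])
    rw [hρ, hre, him, map_zero, map_zero, map_zero]
    simp
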